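/- Let $\tfrac12<\alpha<H<1$, let $[a,b]\subset\mathbb R$ be a compact interval and $p=1/\alpha$. Let $B^H=(B^H_t)_{t\in\mathbb R}$ be a $d$-dimensional fractional Brownian motion with Hurst index $H$ and continuous paths, with paths denoted by $W$. Let $\sigma\in C_b^3(\mathbb R^m;\mathbb R^{m\times d})$, and let $C_\sigma$ be a bound for $\sigma$, $D\sigma$, $D^2\sigma$, $D^3\sigma$ in the supremum norm. Integrals $\int f\,dW$ are Young integrals, i.e. limits of the Riemann sums $\sum f_u(W_v-W_u)$ over the partitions as the mesh tends to $0$. Write $\|W\|_{p\text{-var},[a,b]}=\bigl(\sup\sum\|W_v-W_u\|^p\bigr)^{1/p}$, the supremum being over the finite partitions of $[a,b]$. Then for almost every path $W$ the following holds. For every $y_a\in\mathbb R^m$ the equation $dy_t=\sigma(y_t)\,dW_t$, $t\in[a,b]$, with initial datum $y_a$ has a unique solution $y_t=y_t(W,y_a)$ in $C^\alpha([a,b];\mathbb R^m)$. For every $t\in[a,b]$ the map $y_a\mapsto y_t(W,y_a)$ is Fréchet differentiable on $\mathbb R^m$, and for every $y_a$ the path $t\mapsto\frac{\partial y_t}{\partial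 y}(W,y_a)$ belongs to $C^\alpha([a,b];\mathbb R^{m\times m})$ and is the unique solution in this space of the linear Young equation $$d\xi_t=D\sigma(y_t)\,\xi_t\,dW_t,\quad t\in[a,b],\qquad \xi_a=\mathrm{Id}.$$ Moreover there is a constant $D=D\bigl(m,d,p,[a,b],C_\sigma,\|W\|_{p\text{-var},[a,b]}\bigr)$ such that for all $y_a,\bar y_a\in\mathbb R^m$ and all $t\in[a,b]$ $$\Bigl\|y_t(W,\bar y_a)-y_t(W,y_a)-\frac{\partial y_t}{\partial y}(W,y_a)(\bar y_a-y_a)\Bigr\|\le D\,\|\bar y_a-y_a\|^2 .$$ -/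

import Mathlib

open MeasureTheory ProbabilityTheory Set
open scoped NNReal ENNReal

noncomputable section

namespace YoungEq

/-- `τ 0 ≤ τ 1 ≤ ⋯ ≤ τ n` is a finite partition of `[s, t]`, given by its points (only the values
`τ 0, …, τ n` matter; repeated points are harmless in all the sums below). -/
structure IsPartition (s t : ℝ) (n : ℕ) (τ : ℕ → ℝ) : Prop where
  first : τ 0 = s
  last : τ n = t
  step_le : ∀ i < n, τ i ≤ τ (i + 1)

/-- The `p`-variation semi-norm
`(sup over partitions of [a, b] of ∑ ‖x_v - x_u‖ ^ p) ^ (1 / p)`, with values in `[0, ∞]`. -/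
def pVar {F : Type*} [NormedAddCommGroup F] (p : ℝ) (x : ℝ → F) (a b : ℝ) : ℝ≥0∞ :=
  (⨆ (n : ℕ) (τ : ℕ → ℝ) (_ : IsPartition a b n τ),
    ∑ i ∈ Finset.range n, ‖x (τ (i + 1)) - x (τ i)‖ₑ ^ p) ^ (1 / p)

/-- The path `x`, restricted to `[a, b]`, belongs to the Hölder space `C^α([a, b])`. -/
def IsHolderPath {F : Type*} [NormedAddCommGroup F] (α a b : ℝ) (x : ℝ → F) : Prop :=
  ∃ C : ℝ≥0, HolderOnWith C α.toNNReal x (Icc a b)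

/-- The Young integral `∫_s^t f_r dx_r` exists and is equal to `J`: the Riemann sums
`∑ f_u (x_v - x_u)` over the finite partitions of `[s, t]` converge to `J` as the mesh of the
partition tends to `0`. -/
def HasYoungIntegral {F G : Type*} [NormedAddCommGroup F] [NormedSpace ℝ F]
    [NormedAddCommGroup G] [NormedSpace ℝ G]
    (f : ℝ → F →L[ℝ] G) (x : ℝ → F) (s t : ℝ) (J : G) : Prop :=
  ∀ ε > 0, ∃ δ > 0, ∀ (n : ℕ) (τ : ℕ → ℝ), IsPartition s t n τ →
    (∀ i < n, τ (i + 1) - τ i < δ) →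
      ‖∑ i ∈ Finset.range n, f (τ i) (x (τ (i + 1)) - x (τ i)) - J‖ < ε

/-- `u` is a solution in `C^α([a, b])` of the Young differential equation
`du_t = V(t, u_t) dx_t` with initial datum `u_a = u₀`, i.e.
`u_t = u₀ + ∫_a^t V(r, u_r) dx_r` for all `t ∈ [a, b]`. -/
structure IsYoungSolution {F G : Type*} [NormedAddCommGroup F] [NormedSpace ℝ F]
    [NormedAddCommGroup G] [NormedSpace ℝ G]
    (α a b : ℝ) (x : ℝ → F) (V : ℝ → G → F →L[ℝ] G) (u₀ : G) (u : ℝ → G) : Prop where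
  holder : IsHolderPath α a b u
  initial : u a = u₀
  integral_eq : ∀ t ∈ Icc a b, HasYoungIntegral (fun r => V r (u r)) x a t (u t - u₀)

/-- `u` is the unique solution in `C^α([a, b])`; paths are identified if they agree on `[a, b]`. -/
def IsUniqueYoungSolution {F G : Type*} [NormedAddCommGroup F] [NormedSpace ℝ F]
    [NormedAddCommGroup G] [NormedSpace ℝ G]
    (α a b : ℝ) (x : ℝ → F) (V : ℝ → G → F →L[ℝ] G) (u₀ : G) (u : ℝ → G) : Prop :=
  IsYoungSolution α a b x V u₀ u ∧
    ∀ v : ℝ → G, IsYoungSolution α a b x V u₀ v → EqOn v u (Icc a b)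

/-- `σ ∈ C_b^3(ℝ^m; ℝ^{m×d})`, and `K` bounds `σ`, `Dσ`, `D²σ`, `D³σ`. The `m × d` matrices are
the linear maps `ℝ^d → ℝ^m`. -/
structure IsCb3 {m d : ℕ} (K : ℝ)
    (σ : EuclideanSpace ℝ (Fin m) → EuclideanSpace ℝ (Fin d) →L[ℝ] EuclideanSpace ℝ (Fin m)) :
    Prop where
  contDiff : ContDiff ℝ 3 σ
  bound : ∀ k ≤ 3, ∀ z, ‖iteratedFDeriv ℝ k σ z‖ ≤ K

/-- The coefficient `(t, ξ) ↦ Dσ(y_t) ξ` of the linearized equation `dξ_t = Dσ(y_t) ξ_t dW_t` for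
`m × m` matrices `ξ`: the matrix `Dσ(y_t) ξ dw` sends `v` to `(Dσ(y_t)(ξ v)) dw`. -/
def linearizedField {m d : ℕ}
    (σ : EuclideanSpace ℝ (Fin m) → EuclideanSpace ℝ (Fin d) →L[ℝ] EuclideanSpace ℝ (Fin m))
    (y : ℝ → EuclideanSpace ℝ (Fin m)) (t : ℝ)
    (ξ : EuclideanSpace ℝ (Fin m) →L[ℝ] EuclideanSpace ℝ (Fin m)) :
    EuclideanSpace ℝ (Fin d) →L[ℝ] EuclideanSpace ℝ (Fin m) →L[ℝ] EuclideanSpace ℝ (Fin m) :=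
  ((fderiv ℝ σ (y t)).comp ξ).flip

/-- `B = (B_t)_{t ∈ ℝ}` is a `d`-dimensional fractional Brownian motion with Hurst index `H` on the
probability space `(Ω, P)`: a centred Gaussian process with independent components, each of
covariance `(|s|^{2H} + |t|^{2H} - |t - s|^{2H}) / 2`, and with continuous sample paths. -/
structure IsFractionalBrownianMotion {Ω : Type*} [MeasurableSpace Ω] {d : ℕ} (H : ℝ)
    (B : ℝ → Ω → EuclideanSpace ℝ (Fin d)) (P : Measure Ω) : Prop where
  gaussian : IsGaussianProcess B P
  centered : ∀ t i, ∫ ω, B t ω i ∂P = 0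
  covariance : ∀ s t i j, cov[fun ω => B s ω i, fun ω => B t ω j; P] =
    if i = j then (|s| ^ (2 * H) + |t| ^ (2 * H) - |t - s| ^ (2 * H)) / 2 else 0
  continuous_paths : ∀ᵐ ω ∂P, Continuous fun t => B t ω

end YoungEq

end

open YoungEq

set_option linter.unusedSectionVars false

namespace YoungEq

open Filter Topology

/-! Probability enters only once: since α < H, the Gaussian moments of the increments and dyadic
chaining show that almost every path is α-Hölder on [a, b]. The rest is deterministic, for a fixed
Hölder path x with the control ω(s, t) = (sum of 1/α-powers, supremum over partitions) + (t - s).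

A Young equation dz = g dx is replaced by Davie's inequality z_t - z_s = g_s (x_t - x_s) + O(|t -
s|^(2α)). As 2α > 1, the inequality implies convergence of the Riemann sums, and conversely Young's
estimate gives it back when g and x are Hölder. The remainder fails to be additive only by (g_u -
g_s)(x_t - x_u), so the sewing lemma replaces the unknown constant in O(·) by an explicit one.

The central tool is `local_estimate`: if the size and the increments of g are linearly bounded by
those of z, up to a forcing B, then z and its remainder are bounded on every interval of small
control, with constants depending on α and A only. The estimate is a bootstrap: crude finite bounds
are assumed and then improved until they disappear. `gronwall_control` patches the intervals
together; their number k + 1 depends on ω(a, b) alone, and each costs a factor 2.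

Everything follows by inserting different processes z. Euler schemes give uniform bounds and hence
existence. The path y - y_s gives a Hölder bound independent of the initial datum. The difference y'
- y of two solutions gives uniqueness and Lipschitz dependence, through the four-point inequality
for σ. Difference quotients then have limits, which solve the linearized equation. Finally r = y' -
y - ξh, with h the difference of the initial data, solves a linear equation with r_a = 0, forced by
the Taylor remainder of σ between y and y'. That remainder and its increments are O(‖h‖²), the
increments because D²σ is Lipschitz; so r is O(‖h‖²), which is the asserted bound and identifies ξ
as the Fréchet derivative. -/

/-- `ω` is a control on the interval `[a, b]`: nonnegative and superadditive. -/
structure IsControlOn {ι : Type*} [LinearOrder ι] (ω : ι → ι → ℝ) (a b : ι) : Prop where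
  nonneg : ∀ s t, a ≤ s → s ≤ t → t ≤ b → 0 ≤ ω s t
  superadd : ∀ s u t, a ≤ s → s ≤ u → u ≤ t → t ≤ b → ω s u + ω u t ≤ ω s t

/-! ### Elementary properties of controls -/

namespace IsControlOn

variable {ι : Type*} [LinearOrder ι] {ω : ι → ι → ℝ} {a b : ι}

theorem subinterval (h : IsControlOn ω a b) {s t : ι} (hs : a ≤ s) (ht : t ≤ b) :
    IsControlOn ω s t where
  nonneg _ _ h1 h2 h3 := h.nonneg _ _ (hs.trans h1) h2 (h3.trans ht)
  superadd _ _ _ h1 h2 h3 h4 := h.superadd _ _ _ (hs.trans h1) h2 h3 (h4.trans ht)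

theorem mono (h : IsControlOn ω a b) {s s' t' t : ι} (h1 : a ≤ s) (h2 : s ≤ s') (h3 : s' ≤ t')
    (h4 : t' ≤ t) (h5 : t ≤ b) : ω s' t' ≤ ω s t := by
  have e1 := h.superadd s s' t h1 h2 (h3.trans h4) h5
  have e2 := h.superadd s' t' t (h1.trans h2) h3 h4 h5
  have e3 := h.nonneg s s' h1 h2 ((h3.trans h4).trans h5)
  have e4 := h.nonneg t' t (h1.trans (h2.trans h3)) h4 h5
  linarith

theorem self_eq_zero (h : IsControlOn ω a b) {s : ι} (h1 : a ≤ s) (h2 : s ≤ b) : ω s s = 0 := by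
  have e1 := h.superadd s s s h1 le_rfl le_rfl h2
  have e2 := h.nonneg s s h1 le_rfl h2
  linarith

theorem comp (h : IsControlOn ω a b) {κ : Type*} [LinearOrder κ] {τ : κ → ι} {i j : κ}
    (hτ : MonotoneOn τ (Icc i j)) (hi : a ≤ τ i) (hj : τ j ≤ b) :
    IsControlOn (fun k l => ω (τ k) (τ l)) i j := by
  have key : ∀ k, i ≤ k → k ≤ j → a ≤ τ k ∧ τ k ≤ b := fun k h1 h2 =>
    ⟨hi.trans (hτ ⟨le_rfl, h1.trans h2⟩ ⟨h1, h2⟩ h1),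
      (hτ ⟨h1, h2⟩ ⟨h1.trans h2, le_rfl⟩ h2).trans hj⟩
  refine ⟨fun s t h1 h2 h3 => ?_, fun s u t h1 h2 h3 h4 => ?_⟩
  · exact h.nonneg _ _ (key s h1 (h2.trans h3)).1 (hτ ⟨h1, h2.trans h3⟩ ⟨h1.trans h2, h3⟩ h2)
      (key t (h1.trans h2) h3).2
  · have hu : u ∈ Icc i j := ⟨h1.trans h2, h3.trans h4⟩
    have ht : t ∈ Icc i j := ⟨hu.1.trans h3, h4⟩
    have hs : s ∈ Icc i j := ⟨h1, h2.trans hu.2⟩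
    exact h.superadd _ _ _ (key s hs.1 hs.2).1 (hτ hs hu h2) (hτ hu ht h3) (key t ht.1 ht.2).2

end IsControlOn

/-! ### Sewing: maximal inequalities for almost additive functions -/

/-- The constant in the sewing lemma with exponent `θ`. -/
noncomputable def sewingConst (θ : ℝ) : ℝ := 2 / (1 - 2 ^ (1 - θ))

theorem two_rpow_one_sub_lt {θ : ℝ} (hθ : 1 < θ) : (2 : ℝ) ^ (1 - θ) < 1 :=
  Real.rpow_lt_one_of_one_lt_of_neg (by norm_num) (by linarith)

theorem sewingConst_pos {θ : ℝ} (hθ : 1 < θ) : 0 < sewingConst θ := by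
  have := two_rpow_one_sub_lt hθ
  exact div_pos two_pos (by linarith)

/-- The maximal inequality of Young and Loève, along a sequence of points. -/
theorem discrete_sewing {ω R : ℕ → ℕ → ℝ} {θ K : ℝ} (hθ : 1 < θ) (hK : 0 ≤ K) {m n : ℕ}
    (hmn : m ≤ n) (hω : IsControlOn ω m n) (hR0 : ∀ i, R i i = 0)
    (hR : ∀ i j k, m ≤ i → i ≤ j → j ≤ k → k ≤ n →
      R i k ≤ R i j + R j k + K * ω i k ^ θ) :
    R m n ≤ ∑ i ∈ Finset.Ico m n, R i (i + 1) + sewingConst θ * K * ω m n ^ θ := by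
  obtain ⟨l, hl⟩ : ∃ l, n - m = l := ⟨_, rfl⟩
  induction l using Nat.strong_induction_on generalizing m n with
  | _ l ih =>
  have hc := sewingConst_pos hθ
  rcases hmn.eq_or_lt with rfl | hlt
  · simp only [hR0, Finset.Ico_self, Finset.sum_empty, zero_add]
    have := hω.nonneg m m le_rfl le_rfl le_rfl
    positivity
  have hw := hω.nonneg m n le_rfl hmn le_rfl
  classical
  -- Split at the last index j ≤ n - 1 with at most half of the control to its left. By
  -- superadditivity at most half lies to the right of j + 1, so the induction hypothesis gains on
  -- both sides, and the single link from j to j + 1 already belongs to the sum.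
  set P : ℕ → Prop := fun j => m ≤ j ∧ ω m j ≤ ω m n / 2 with hP
  have hPm : P m := ⟨le_rfl, by rw [hω.self_eq_zero le_rfl hmn]; positivity⟩
  set j := Nat.findGreatest P (n - 1) with hj
  have hjP : P j := Nat.findGreatest_spec (P := P) (m := m) (by omega) hPm
  have hjn : j ≤ n - 1 := Nat.findGreatest_le _
  have hmj := hjP.1
  have hright : ω (j + 1) n ≤ ω m n / 2 := by
    rcases (show j + 1 ≤ n by omega).eq_or_lt with h | h
    · rw [h, hω.self_eq_zero hmn le_rfl]; positivity
    · have h1 : ¬ P (j + 1) := Nat.findGreatest_is_greatest (P := P) (n := n - 1) (by omega)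
        (by omega)
      have h2 : ω m n / 2 < ω m (j + 1) := by
        by_contra h3
        exact h1 ⟨by omega, not_lt.1 h3⟩
      have := hω.superadd m (j + 1) n le_rfl (by omega) (by omega) le_rfl
      linarith
  have i1 := ih (j - m) (by omega) hmj (hω.subinterval le_rfl (by omega))
    (fun a b c h1 h2 h3 h4 => hR a b c h1 h2 h3 (by omega)) rfl
  have i2 := ih (n - (j + 1)) (by omega) (by omega) (hω.subinterval (by omega) le_rfl)
    (fun a b c h1 h2 h3 h4 => hR a b c (by omega) h2 h3 h4) rfl
  have r1 := hR m j n le_rfl hmj (by omega) le_rfl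
  have r2 := hR j (j + 1) n hmj (by omega) (by omega) le_rfl
  have r3 : ω j n ^ θ ≤ ω m n ^ θ :=
    Real.rpow_le_rpow (hω.nonneg _ _ hmj (by omega) le_rfl)
      (hω.mono le_rfl hmj (by omega) le_rfl le_rfl) (by linarith)
  have r4 : ω m j ^ θ ≤ (ω m n / 2) ^ θ :=
    Real.rpow_le_rpow (hω.nonneg _ _ le_rfl hmj (by omega)) hjP.2 (by linarith)
  have r5 : ω (j + 1) n ^ θ ≤ (ω m n / 2) ^ θ :=
    Real.rpow_le_rpow (hω.nonneg _ _ (by omega) (by omega) le_rfl) hright (by linarith)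
  have hsum : ∑ i ∈ Finset.Ico m n, R i (i + 1) = ∑ i ∈ Finset.Ico m j, R i (i + 1) + R j (j + 1)
      + ∑ i ∈ Finset.Ico (j + 1) n, R i (i + 1) := by
    rw [← Finset.sum_Ico_consecutive _ hmj (show j ≤ n by omega),
      Finset.sum_eq_sum_Ico_succ_bot (show j < n by omega)]
    ring
  have hhalf : 2 * (ω m n / 2) ^ θ = 2 ^ (1 - θ) * ω m n ^ θ := by
    rw [Real.div_rpow hw (by norm_num), Real.rpow_sub (by norm_num), Real.rpow_one]
    ring
  -- This identity fixes the constant: the two halves cost c 2^(1-θ), the two insertions of points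
  -- cost 2, and together they must give c back.
  have hcθ : sewingConst θ * 2 ^ (1 - θ) + 2 = sewingConst θ := by
    have := two_rpow_one_sub_lt hθ
    rw [sewingConst]
    field_simp [show (1 : ℝ) - 2 ^ (1 - θ) ≠ 0 by linarith]
    ring
  have hcK : 0 ≤ sewingConst θ * K := by positivity
  have s1 := mul_le_mul_of_nonneg_left r4 hcK
  have s2 := mul_le_mul_of_nonneg_left r5 hcK
  have s3 := mul_le_mul_of_nonneg_left r3 hK
  have s4 : sewingConst θ * K * (2 * (ω m n / 2) ^ θ) + 2 * (K * ω m n ^ θ)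
      = sewingConst θ * K * ω m n ^ θ := by
    rw [hhalf]
    calc _ = (sewingConst θ * 2 ^ (1 - θ) + 2) * (K * ω m n ^ θ) := by ring
      _ = _ := by rw [hcθ]; ring
  rw [hsum]
  linarith

/-- The points `s + i (t - s) / n` of the uniform partition of `[s, t]` into `n` pieces. -/
noncomputable def uniformPoint (s t : ℝ) (n i : ℕ) : ℝ := s + i * ((t - s) / n)

theorem uniformPoint_succ_sub (s t : ℝ) (n i : ℕ) :
    uniformPoint s t n (i + 1) - uniformPoint s t n i = (t - s) / n := by
  simp only [uniformPoint]; push_cast; ring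

@[simp] theorem uniformPoint_zero (s t : ℝ) (n : ℕ) : uniformPoint s t n 0 = s := by
  simp [uniformPoint]

theorem uniformPoint_last (s t : ℝ) {n : ℕ} (hn : n ≠ 0) : uniformPoint s t n n = t := by
  simp only [uniformPoint]; field_simp; ring

theorem uniformPoint_monotone {s t : ℝ} (hst : s ≤ t) (n : ℕ) : Monotone (uniformPoint s t n) := by
  refine monotone_nat_of_le_succ fun i => ?_
  have := uniformPoint_succ_sub s t n i
  have h2 : 0 ≤ (t - s) / n := div_nonneg (by linarith) (by positivity)
  linarith

theorem tendsto_nat_mul_div_rpow {θ : ℝ} (hθ : 1 < θ) {x : ℝ} (hx : 0 ≤ x) :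
    Tendsto (fun n : ℕ => (n : ℝ) * (x / n) ^ θ) atTop (𝓝 0) := by
  have h1 : Tendsto (fun n : ℕ => x ^ θ * (n : ℝ) ^ (-(θ - 1))) atTop (𝓝 (x ^ θ * 0)) :=
    ((tendsto_rpow_neg_atTop (by linarith)).comp tendsto_natCast_atTop_atTop).const_mul _
  rw [mul_zero] at h1
  refine h1.congr' ?_
  filter_upwards [eventually_gt_atTop 0] with n hn
  have hn' : (0 : ℝ) < n := by exact_mod_cast hn
  rw [Real.div_rpow hx hn'.le, show -(θ - 1) = 1 - θ by ring, Real.rpow_sub hn', Real.rpow_one]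
  ring

/-- The maximal inequality for an almost additive function on an interval which is `O(|t - s|^θ)`
with an uncontrolled constant. -/
theorem real_sewing {ω R : ℝ → ℝ → ℝ} {θ K M a b : ℝ} (hθ : 1 < θ) (hK : 0 ≤ K)
    (hω : IsControlOn ω a b) (hR0 : ∀ s, R s s = 0)
    (hR : ∀ s u t, a ≤ s → s ≤ u → u ≤ t → t ≤ b → R s t ≤ R s u + R u t + K * ω s t ^ θ)
    (hM : ∀ s t, a ≤ s → s ≤ t → t ≤ b → R s t ≤ M * (t - s) ^ θ) {s t : ℝ} (hs : a ≤ s)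
    (hst : s ≤ t) (ht : t ≤ b) : R s t ≤ sewingConst θ * K * ω s t ^ θ := by
  -- Along n equal pieces the crude bound contributes M n ((t - s)/n)^θ, which vanishes as n → ∞
  -- because θ > 1. Only the existence of M matters.
  have hlim : Tendsto (fun n : ℕ => M * ((n : ℝ) * ((t - s) / n) ^ θ)
      + sewingConst θ * K * ω s t ^ θ) atTop (𝓝 (M * 0 + sewingConst θ * K * ω s t ^ θ)) :=
    ((tendsto_nat_mul_div_rpow hθ (by linarith)).const_mul M).add_const _
  rw [mul_zero, zero_add] at hlim
  refine ge_of_tendsto hlim ?_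
  filter_upwards [eventually_gt_atTop 0] with n hn
  have hmono := uniformPoint_monotone hst n
  have hlast := uniformPoint_last s t hn.ne'
  have hin : ∀ i, a ≤ uniformPoint s t n i := fun i =>
    hs.trans (by simpa using hmono (Nat.zero_le i))
  have hin' : ∀ i ≤ n, uniformPoint s t n i ≤ b := fun i hi => by
    have := hmono hi
    linarith
  have := discrete_sewing (R := fun i j => R (uniformPoint s t n i) (uniformPoint s t n j))
    (m := 0) (n := n) hθ hK (Nat.zero_le _)
    (hω.comp (τ := uniformPoint s t n) (hmono.monotoneOn _) (hin 0) (hin' n le_rfl))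
    (fun i => hR0 _)
    (fun i j k h1 h2 h3 h4 => hR _ _ _ (hin i) (hmono h2) (hmono h3) (hin' k h4))
  simp only [uniformPoint_zero, hlast] at this
  refine this.trans (add_le_add_left ?_ _)
  calc ∑ i ∈ Finset.Ico 0 n, R (uniformPoint s t n i) (uniformPoint s t n (i + 1))
      ≤ ∑ i ∈ Finset.Ico 0 n, M * ((t - s) / n) ^ θ := by
        refine Finset.sum_le_sum fun i hi => ?_
        rw [← uniformPoint_succ_sub s t n i]
        exact hM _ _ (hin i) (hmono (Nat.le_succ i))
          (hin' _ (Nat.succ_le_of_lt (Finset.mem_Ico.1 hi).2))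
    _ = M * ((n : ℝ) * ((t - s) / n) ^ θ) := by
        simp; ring

/-- A family of bounds that can be halved up to an additive constant. -/
theorem le_of_halving {κ : Type*} {r w : κ → ℝ} {M₀ E : ℝ} (hw : ∀ i, 0 ≤ w i) (hM₀ : 0 ≤ M₀)
    (hE : 0 ≤ E) (h₀ : ∀ i, r i ≤ M₀ * w i)
    (hstep : ∀ M, 0 ≤ M → (∀ i, r i ≤ M * w i) → ∀ i, r i ≤ (M / 2 + E) * w i) (i : κ) :
    r i ≤ 2 * E * w i := by
  -- The map M ↦ M/2 + E contracts to its fixed point 2E, so iteration forgets the initial constant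
  -- M₀.
  have key : ∀ n : ℕ, ∀ i, r i ≤ (2 * E + M₀ * (1 / 2) ^ n) * w i := by
    intro n
    induction n with
    | zero =>
      intro i
      have := h₀ i
      simp only [pow_zero, mul_one]
      nlinarith [mul_nonneg hE (hw i)]
    | succ n ih =>
      intro i
      refine (hstep _ (by positivity) ih i).trans (le_of_eq ?_)
      ring
  have hlim : Tendsto (fun n : ℕ => (2 * E + M₀ * (1 / 2) ^ n) * w i) atTop
      (𝓝 ((2 * E + M₀ * 0) * w i)) :=
    (((tendsto_pow_atTop_nhds_zero_of_lt_one (by norm_num) (by norm_num)).const_mul M₀).const_add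
      _).mul_const _
  rw [mul_zero, add_zero] at hlim
  exact ge_of_tendsto' hlim fun n => key n i

/-! ### Local a priori estimate and Gronwall inequality -/

/-- The constant in the local estimates for Young equations. -/
noncomputable def localConst (α A : ℝ) : ℝ := 4 * (sewingConst (2 * α) + 1) * (A + 1) ^ 2

theorem localConst_ge_one {α A : ℝ} (hα : 1 / 2 < α) (hA : 0 ≤ A) : 1 ≤ localConst α A := by
  have := sewingConst_pos (show 1 < 2 * α by linarith)
  rw [localConst]
  nlinarith [mul_nonneg this.le hA, mul_nonneg (mul_nonneg this.le hA) hA]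

theorem remainder_self {ι F G : Type*} [NormedAddCommGroup F] [NormedSpace ℝ F]
    [NormedAddCommGroup G] [NormedSpace ℝ G] (x : ι → F) (z : ι → G) (g : ι → F →L[ℝ] G) (s : ι) :
    ‖z s - z s - g s (x s - x s)‖ = 0 := by simp

/-- The germ g_s (x_t - x_s) fails to be additive exactly by (g_u - g_s)(x_t - x_u); this is the
defect that the sewing lemma has to control. -/
theorem remainder_triangle {ι F G : Type*} [NormedAddCommGroup F] [NormedSpace ℝ F]
    [NormedAddCommGroup G] [NormedSpace ℝ G] (x : ι → F) (z : ι → G) (g : ι → F →L[ℝ] G)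
    (s u t : ι) : ‖z t - z s - g s (x t - x s)‖ ≤ ‖z u - z s - g s (x u - x s)‖
      + ‖z t - z u - g u (x t - x u)‖ + ‖g u - g s‖ * ‖x t - x u‖ := by
  have : z t - z s - g s (x t - x s) = (z u - z s - g s (x u - x s))
      + (z t - z u - g u (x t - x u)) + (g u - g s) (x t - x u) := by
    simp only [map_sub, sub_apply]
    abel
  rw [this]
  exact (norm_add_le _ _).trans (add_le_add (norm_add_le _ _) ((g u - g s).le_opNorm _))

/-- The local a priori estimate for `dz = g dx`, where `g` depends on `z` in a Lipschitz way. The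
interval lies in an arbitrary linear order, so that it applies to paths and to Euler schemes. -/
theorem local_estimate {ι F G : Type*} [LinearOrder ι] [NormedAddCommGroup F] [NormedSpace ℝ F]
    [NormedAddCommGroup G] [NormedSpace ℝ G] {x : ι → F} {z : ι → G} {g : ι → F →L[ℝ] G}
    {ω : ι → ι → ℝ} {s₀ t₀ : ι} {α A B M₀ Z₀ : ℝ} (hα : 1 / 2 < α) (hA : 0 ≤ A) (hB : 0 ≤ B)
    (hst₀ : s₀ ≤ t₀) (hω : IsControlOn ω s₀ t₀)
    (hsmall : 2 * localConst α A * ω s₀ t₀ ^ α ≤ 1)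
    (hx : ∀ s t, s₀ ≤ s → s ≤ t → t ≤ t₀ → ‖x t - x s‖ ≤ ω s t ^ α)
    (hg : ∀ s, s₀ ≤ s → s ≤ t₀ → ‖g s‖ ≤ A * ‖z s‖ + B)
    (hgd : ∀ s t, s₀ ≤ s → s ≤ t → t ≤ t₀ →
      ‖g t - g s‖ ≤ A * ‖z t - z s‖ + (A * max ‖z s‖ ‖z t‖ + B) * ω s t ^ α)
    (hsew : ∀ K, 0 ≤ K → (∀ s u t, s₀ ≤ s → s ≤ u → u ≤ t → t ≤ t₀ →
        ‖g u - g s‖ * ‖x t - x u‖ ≤ K * ω s t ^ (2 * α)) →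
      ∀ s t, s₀ ≤ s → s ≤ t → t ≤ t₀ →
        ‖z t - z s - g s (x t - x s)‖ ≤ sewingConst (2 * α) * K * ω s t ^ (2 * α))
    (hM₀ : ∀ s t, s₀ ≤ s → s ≤ t → t ≤ t₀ →
      ‖z t - z s - g s (x t - x s)‖ ≤ M₀ * ω s t ^ (2 * α))
    (hZ₀ : ∀ s, s₀ ≤ s → s ≤ t₀ → ‖z s‖ ≤ Z₀) :
    (∀ t, s₀ ≤ t → t ≤ t₀ → ‖z t‖ ≤ 2 * ‖z s₀‖ + B) ∧
    (∀ s t, s₀ ≤ s → s ≤ t → t ≤ t₀ → ‖z t - z s - g s (x t - x s)‖ ≤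
      localConst α A * (‖z s₀‖ + B) * ω s t ^ (2 * α)) ∧
    (∀ s t, s₀ ≤ s → s ≤ t → t ≤ t₀ → ‖z t - z s‖ ≤
      localConst α A * (‖z s₀‖ + B) * ω s t ^ α) := by
  set c := sewingConst (2 * α) with hc
  have hc0 : 0 < c := sewingConst_pos (by linarith)
  have hL : localConst α A = 4 * (c + 1) * (A + 1) ^ 2 := rfl
  set q := ω s₀ t₀ ^ α with hq
  have hω0 : ∀ s t, s₀ ≤ s → s ≤ t → t ≤ t₀ → 0 ≤ ω s t := hω.nonneg
  have hp0 : ∀ s t, s₀ ≤ s → s ≤ t → t ≤ t₀ → 0 ≤ ω s t ^ α := fun s t h1 h2 h3 =>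
    Real.rpow_nonneg (hω0 s t h1 h2 h3) _
  have hq0 : 0 ≤ q := hp0 _ _ le_rfl hst₀ le_rfl
  have hpmono : ∀ s s' t' t, s₀ ≤ s → s ≤ s' → s' ≤ t' → t' ≤ t → t ≤ t₀ →
      ω s' t' ^ α ≤ ω s t ^ α := fun s s' t' t h1 h2 h3 h4 h5 =>
    Real.rpow_le_rpow (hω0 _ _ (h1.trans h2) h3 (h4.trans h5)) (hω.mono h1 h2 h3 h4 h5)
      (by linarith)
  have hpq : ∀ s t, s₀ ≤ s → s ≤ t → t ≤ t₀ → ω s t ^ α ≤ q := fun s t h1 h2 h3 =>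
    hpmono _ _ _ _ le_rfl h1 h2 h3 le_rfl
  have hsq : ∀ s t, s₀ ≤ s → s ≤ t → t ≤ t₀ → ω s t ^ (2 * α) = ω s t ^ α * ω s t ^ α :=
    fun s t h1 h2 h3 => by
      rw [two_mul, Real.rpow_add_of_nonneg (hω0 s t h1 h2 h3) (by linarith) (by linarith)]
  have hAA : 1 ≤ (A + 1) ^ 2 := by nlinarith
  -- The factor 4 (c + 1) (A + 1)² in `localConst` is chosen so that smallness of the control makes
  -- cAq, (A + 1)q and c(A + 1)²q all at most 1/8.
  have hq1 : 8 * ((c + 1) * (A + 1) ^ 2) * q ≤ 1 := by rw [hL] at hsmall; linarith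
  have hqle1 : q ≤ 1 := by nlinarith [mul_nonneg hc0.le (sq_nonneg (A + 1))]
  have hcA1 : A + 1 ≤ (c + 1) * (A + 1) ^ 2 := by nlinarith [mul_nonneg hc0.le (sq_nonneg (A + 1))]
  have hcA2 : c * A ≤ (c + 1) * (A + 1) ^ 2 := by nlinarith [mul_nonneg hc0.le hA]
  have hcA3 : c * (A + 1) ^ 2 ≤ (c + 1) * (A + 1) ^ 2 := by nlinarith
  have hq2 : c * A * q ≤ 1 / 8 := by nlinarith
  have hq3 : (A + 1) * q ≤ 1 / 8 := by nlinarith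
  have hq4 : c * (A + 1) ^ 2 * q ≤ 1 / 8 := by nlinarith
  set R : ι → ι → ℝ := fun s t => ‖z t - z s - g s (x t - x s)‖ with hR
  have hz : ∀ M Z, 0 ≤ Z → (∀ s, s₀ ≤ s → s ≤ t₀ → ‖z s‖ ≤ Z) →
      (∀ s t, s₀ ≤ s → s ≤ t → t ≤ t₀ → R s t ≤ M * ω s t ^ (2 * α)) →
      ∀ s t, s₀ ≤ s → s ≤ t → t ≤ t₀ →
        ‖z t - z s‖ ≤ M * ω s t ^ (2 * α) + (A * Z + B) * ω s t ^ α := by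
    intro M Z hZ0 hZ hM s t h1 h2 h3
    have e1 : ‖z t - z s‖ ≤ R s t + ‖g s (x t - x s)‖ := by
      have := norm_add_le (z t - z s - g s (x t - x s)) (g s (x t - x s))
      rwa [sub_add_cancel] at this
    have e2 : ‖g s (x t - x s)‖ ≤ (A * Z + B) * ω s t ^ α := by
      refine ((g s).le_opNorm _).trans ?_
      refine mul_le_mul ((hg s h1 (h2.trans h3)).trans ?_) (hx s t h1 h2 h3) (norm_nonneg _)
        (by positivity)
      have := mul_le_mul_of_nonneg_left (hZ s h1 (h2.trans h3)) hA
      linarith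
    linarith [hM s t h1 h2 h3]
  -- the remainder, given a bound for `z`
  have hrem : ∀ Z, 0 ≤ Z → (∀ s, s₀ ≤ s → s ≤ t₀ → ‖z s‖ ≤ Z) →
      ∀ s t, s₀ ≤ s → s ≤ t → t ≤ t₀ →
        R s t ≤ 2 * (c * ((A + 1) * (A * Z + B))) * ω s t ^ (2 * α) := by
    intro Z hZ0 hZ s t h1 h2 h3
    have hAZ : 0 ≤ A * Z + B := by positivity
    refine le_of_halving (κ := {p : ι × ι // s₀ ≤ p.1 ∧ p.1 ≤ p.2 ∧ p.2 ≤ t₀})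
      (r := fun p => R p.1.1 p.1.2) (w := fun p => ω p.1.1 p.1.2 ^ (2 * α)) (M₀ := max M₀ 0)
      (fun p => Real.rpow_nonneg (hω0 _ _ p.2.1 p.2.2.1 p.2.2.2) _) (le_max_right _ _)
      (by positivity) (fun p => ?_) (fun M hM h p => ?_) ⟨(s, t), h1, h2, h3⟩
    · refine (hM₀ _ _ p.2.1 p.2.2.1 p.2.2.2).trans ?_
      exact mul_le_mul_of_nonneg_right (le_max_left _ _)
        (Real.rpow_nonneg (hω0 _ _ p.2.1 p.2.2.1 p.2.2.2) _)
    · have hM' : ∀ s t, s₀ ≤ s → s ≤ t → t ≤ t₀ → R s t ≤ M * ω s t ^ (2 * α) :=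
        fun s t h1 h2 h3 => h ⟨(s, t), h1, h2, h3⟩
      -- If M bounds the remainder, one factor ω^α of ω^(2α) can be traded for q, so g has
      -- increments at most (AMq + (A + 1)(AZ + B)) ω^α. Sewing multiplies this by c, and cAq ≤ 1/8
      -- gives a bound of the form M/2 + E.
      have := hsew (A * M * q + (A + 1) * (A * Z + B)) (by positivity) ?_ _ _ p.2.1 p.2.2.1 p.2.2.2
      · refine this.trans (mul_le_mul_of_nonneg_right ?_
          (Real.rpow_nonneg (hω0 _ _ p.2.1 p.2.2.1 p.2.2.2) _))
        nlinarith
      · intro s u t h1 h2 h3 h4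
        have hut := h3.trans h4
        have hsu := hpmono s s u t h1 le_rfl h2 h3 h4
        have hut' := hpmono s u t t h1 h2 h3 le_rfl h4
        have hsu0 := hp0 s u h1 h2 hut
        have hst0 := hp0 s t h1 (h2.trans h3) h4
        have e1 := hz M Z hZ0 hZ hM' s u h1 h2 hut
        have e2 : max ‖z s‖ ‖z u‖ ≤ Z := max_le (hZ s h1 (h2.trans hut)) (hZ u (h1.trans h2) hut)
        have e3 : ‖g u - g s‖ ≤ (A * M * q + (A + 1) * (A * Z + B)) * ω s t ^ α := by
          refine (hgd s u h1 h2 hut).trans ?_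
          have e4 : ω s u ^ (2 * α) ≤ q * ω s u ^ α := by
            rw [hsq s u h1 h2 hut]
            exact mul_le_mul_of_nonneg_right (hpq s u h1 h2 hut) hsu0
          have e5 : A * ‖z u - z s‖ ≤ A * (M * (q * ω s u ^ α) + (A * Z + B) * ω s u ^ α) := by
            refine mul_le_mul_of_nonneg_left (e1.trans ?_) hA
            have := mul_le_mul_of_nonneg_left e4 hM
            linarith
          have e6 : (A * max ‖z s‖ ‖z u‖ + B) * ω s u ^ α ≤ (A * Z + B) * ω s u ^ α := by
            refine mul_le_mul_of_nonneg_right ?_ hsu0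
            have := mul_le_mul_of_nonneg_left e2 hA
            linarith
          calc _ ≤ (A * M * q + (A + 1) * (A * Z + B)) * ω s u ^ α := by linarith
            _ ≤ _ := mul_le_mul_of_nonneg_left hsu (by positivity)
        calc ‖g u - g s‖ * ‖x t - x u‖
            ≤ ((A * M * q + (A + 1) * (A * Z + B)) * ω s t ^ α) * ω s t ^ α :=
              mul_le_mul e3 ((hx u t (h1.trans h2) h3 h4).trans hut') (norm_nonneg _)
                (by positivity)
          _ = _ := by rw [hsq s t h1 (h2.trans h3) h4]; ring
  have hbound : ∀ t, s₀ ≤ t → t ≤ t₀ → ‖z t‖ ≤ 2 * ‖z s₀‖ + B := by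
    intro t h1 h2
    -- A second bootstrap, now for the bound Z of z: the remainder bound just obtained is linear in
    -- Z, and smallness of q turns Z into Z/2 + (‖z s₀‖ + B/2).
    have := le_of_halving (κ := {t : ι // s₀ ≤ t ∧ t ≤ t₀}) (r := fun t => ‖z t‖) (w := fun _ => 1)
      (M₀ := max Z₀ 0) (E := ‖z s₀‖ + B / 2) (fun _ => zero_le_one) (le_max_right _ _)
      (by positivity) (fun t => by simpa using Or.inl (hZ₀ _ t.2.1 t.2.2))
      (fun Z hZ0 hZ t => ?_) ⟨t, h1, h2⟩
    · simp only [mul_one] at this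
      linarith
    · simp only [mul_one, Subtype.forall] at hZ ⊢
      have hZ' : ∀ s, s₀ ≤ s → s ≤ t₀ → ‖z s‖ ≤ Z := fun s h1 h2 => hZ s ⟨h1, h2⟩
      obtain ⟨t, h1, h2⟩ := t
      have hAZ : 0 ≤ A * Z + B := by positivity
      have e1 := hz _ Z hZ0 hZ' (hrem Z hZ0 hZ') s₀ t le_rfl h1 h2
      have e2 : ‖z t‖ ≤ ‖z s₀‖ + ‖z t - z s₀‖ := by
        have := norm_add_le (z s₀) (z t - z s₀)
        simpa using this
      have hp := hpq s₀ t le_rfl h1 h2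
      have hp' := hp0 s₀ t le_rfl h1 h2
      have e3 : ω s₀ t ^ (2 * α) ≤ q := by
        rw [hsq _ _ le_rfl h1 h2]
        calc ω s₀ t ^ α * ω s₀ t ^ α ≤ q * 1 := mul_le_mul hp (hp.trans hqle1) hp' hq0
          _ = q := mul_one q
      have e4 : ‖z t - z s₀‖ ≤ (2 * c * (A + 1) * q + q) * (A * Z + B) := by
        refine e1.trans ?_
        have e5 := mul_le_mul_of_nonneg_left e3
          (show 0 ≤ 2 * (c * ((A + 1) * (A * Z + B))) by positivity)
        have e6 := mul_le_mul_of_nonneg_left hp hAZ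
        linarith
      have e7 : A * Z + B ≤ (A + 1) * (Z + B) := by nlinarith [mul_nonneg hA hB]
      have e8 : (2 * c * (A + 1) * q + q) * (A * Z + B)
          ≤ (2 * c * (A + 1) * q + q) * ((A + 1) * (Z + B)) :=
        mul_le_mul_of_nonneg_left e7 (by positivity)
      have e9 : (2 * c * (A + 1) * q + q) * ((A + 1) * (Z + B))
          = (2 * (c * (A + 1) ^ 2 * q) + (A + 1) * q) * (Z + B) := by ring
      have e10 : (2 * (c * (A + 1) ^ 2 * q) + (A + 1) * q) * (Z + B) ≤ (1 / 2) * (Z + B) :=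
        mul_le_mul_of_nonneg_right (by linarith) (by positivity)
      linarith
  have hAB : A * (2 * ‖z s₀‖ + B) + B ≤ 2 * (A + 1) * (‖z s₀‖ + B) := by
    nlinarith [norm_nonneg (z s₀), mul_nonneg hA hB]
  have hrem' : ∀ s t, s₀ ≤ s → s ≤ t → t ≤ t₀ →
      R s t ≤ 4 * (c * (A + 1) ^ 2) * (‖z s₀‖ + B) * ω s t ^ (2 * α) := by
    intro s t h1 h2 h3
    refine (hrem _ (by positivity) hbound s t h1 h2 h3).trans
      (mul_le_mul_of_nonneg_right ?_ (Real.rpow_nonneg (hω0 _ _ h1 h2 h3) _))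
    calc 2 * (c * ((A + 1) * (A * (2 * ‖z s₀‖ + B) + B)))
        ≤ 2 * (c * ((A + 1) * (2 * (A + 1) * (‖z s₀‖ + B)))) := by gcongr
      _ = _ := by ring
  refine ⟨hbound, fun s t h1 h2 h3 => ?_, fun s t h1 h2 h3 => ?_⟩
  · refine (hrem' s t h1 h2 h3).trans
      (mul_le_mul_of_nonneg_right ?_ (Real.rpow_nonneg (hω0 _ _ h1 h2 h3) _))
    rw [hL]
    refine mul_le_mul_of_nonneg_right (by nlinarith) (by positivity)
  · have e1 := hz _ _ (by positivity) hbound hrem' s t h1 h2 h3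
    have hp := hp0 s t h1 h2 h3
    have e2 : 4 * (c * (A + 1) ^ 2) * (‖z s₀‖ + B) * ω s t ^ (2 * α)
        ≤ 4 * (c * (A + 1) ^ 2) * (‖z s₀‖ + B) * ω s t ^ α := by
      refine mul_le_mul_of_nonneg_left ?_ (by positivity)
      rw [hsq s t h1 h2 h3]
      exact mul_le_of_le_one_left hp ((hpq s t h1 h2 h3).trans hqle1)
    have e3 := mul_le_mul_of_nonneg_right hAB hp
    refine e1.trans ((add_le_add e2 e3).trans ?_)
    rw [← add_mul, ← add_mul, hL]
    refine mul_le_mul_of_nonneg_right (mul_le_mul_of_nonneg_right (by nlinarith) (by positivity)) hp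

/-- A multiplicative Gronwall inequality along a control. -/
theorem gronwall_control {ω : ℝ → ℝ → ℝ} {a b ε : ℝ} {f : ℝ → ℝ} (hω : IsControlOn ω a b)
    (hf : ContinuousOn f (Icc a b)) (hf0 : ∀ t ∈ Icc a b, 0 ≤ f t)
    (hloc : ∀ s t, a ≤ s → s ≤ t → t ≤ b → ω s t ≤ ε → f t ≤ 2 * f s) (k : ℕ) :
    ∀ s t, a ≤ s → s ≤ t → t ≤ b → ω s t ≤ (k + 1) * ε → f t ≤ 2 ^ (k + 1) * f s := by
  induction k with
  | zero => simpa using hloc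
  | succ k ih =>
    intro s t hs hst ht h
    have hsI : s ∈ Icc a b := ⟨hs, hst.trans ht⟩
    -- The control need not be continuous, so no point with ω s v equal to (k + 1)ε is available. At
    -- v = sup S the bound from s passes to the limit along S. For u > v superadditivity leaves ω u
    -- t ≤ ε, and u → v transfers the local bound; only continuity of f is used.
    set S : Set ℝ := {u | s ≤ u ∧ u ≤ t ∧ ω s u ≤ (k + 1) * ε} with hS
    have hfs := hf0 s hsI
    by_cases hε : 0 ≤ ε
    swap
    · have h1 := hω.nonneg s t hs hst ht
      push_cast at h
      nlinarith
    have hsS : s ∈ S := ⟨le_rfl, hst, by rw [hω.self_eq_zero hs hsI.2]; positivity⟩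
    have hbdd : BddAbove S := ⟨t, fun u hu => hu.2.1⟩
    set v := sSup S with hv
    have hsv : s ≤ v := le_csSup hbdd hsS
    have hvt : v ≤ t := csSup_le ⟨s, hsS⟩ fun u hu => hu.2.1
    have hvI : v ∈ Icc a b := ⟨hs.trans hsv, hvt.trans ht⟩
    have hSI : S ⊆ Icc a b := fun u hu => ⟨hs.trans hu.1, hu.2.1.trans ht⟩
    have hfv : f v ≤ 2 ^ (k + 1) * f s := by
      have hcl : v ∈ closure S := csSup_mem_closure ⟨s, hsS⟩ hbdd
      have : (𝓝[S] v).NeBot := mem_closure_iff_nhdsWithin_neBot.1 hcl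
      refine le_of_tendsto ((hf v hvI).mono_left (nhdsWithin_mono _ hSI)) ?_
      filter_upwards [self_mem_nhdsWithin] with u hu
      exact ih s u hs hu.1 (hu.2.1.trans ht) hu.2.2
    have hft : f t ≤ 2 * f v := by
      rcases hvt.eq_or_lt with hvt' | hvt'
      · have := hf0 v hvI
        rw [← hvt']; linarith
      · have hsub : Ioc v t ⊆ Icc a b := fun u hu => ⟨hvI.1.trans hu.1.le, hu.2.trans ht⟩
        have : (𝓝[Ioc v t] v).NeBot := by
          rw [nhdsWithin_Ioc_eq_nhdsGT hvt']; infer_instance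
        refine ge_of_tendsto (((hf v hvI).mono_left (nhdsWithin_mono _ hsub)).const_mul 2) ?_
        filter_upwards [self_mem_nhdsWithin] with u hu
        have hsu : s ≤ u := hsv.trans hu.1.le
        refine hloc u t (hs.trans hsu) hu.2 ht ?_
        have h1 : ¬ ω s u ≤ (k + 1) * ε := fun h2 => by
          have : u ≤ v := le_csSup hbdd ⟨hsu, hu.2, h2⟩
          exact absurd hu.1 (not_lt.2 this)
        have h2 := hω.superadd s u t hs hsu hu.2 ht
        push_cast at h
        linarith
    calc f t ≤ 2 * f v := hft
      _ ≤ 2 * (2 ^ (k + 1) * f s) := by linarith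
      _ = _ := by ring

/-! ### Davie's formulation and its equivalence with Young integrals -/

section Davie

variable {F G : Type*} [NormedAddCommGroup F] [NormedSpace ℝ F] [NormedAddCommGroup G]
  [NormedSpace ℝ G] {x : ℝ → F} {z : ℝ → G} {g : ℝ → F →L[ℝ] G} {α a b : ℝ}

/-- `dz = g dx` on `[a, b]` in the sense of Davie: `z_t - z_s = g_s (x_t - x_s) + O(|t-s|^(2α))`. -/
def IsDavie (α a b : ℝ) (x : ℝ → F) (g : ℝ → F →L[ℝ] G) (z : ℝ → G) : Prop :=
  ∃ M, 0 ≤ M ∧ ∀ s t, a ≤ s → s ≤ t → t ≤ b →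
    ‖z t - z s - g s (x t - x s)‖ ≤ M * (t - s) ^ (2 * α)

theorem IsDavie.sub {z' : ℝ → G} {g' : ℝ → F →L[ℝ] G} (h : IsDavie α a b x g z)
    (h' : IsDavie α a b x g' z') :
    IsDavie α a b x (fun t => g t - g' t) (fun t => z t - z' t) := by
  obtain ⟨M, hM0, hM⟩ := h
  obtain ⟨M', hM0', hM'⟩ := h'
  refine ⟨M + M', by positivity, fun s t h1 h2 h3 => ?_⟩
  have e : z t - z' t - (z s - z' s) - (g s - g' s) (x t - x s)
      = (z t - z s - g s (x t - x s)) - (z' t - z' s - g' s (x t - x s)) := by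
    rw [sub_apply]; abel
  rw [e, add_mul]
  exact (norm_sub_le _ _).trans (add_le_add (hM s t h1 h2 h3) (hM' s t h1 h2 h3))

theorem IsDavie.sub_const (h : IsDavie α a b x g z) (c : G) :
    IsDavie α a b x g (fun t => z t - c) := by
  simpa [IsDavie] using h

theorem IsDavie.map {G' : Type*} [NormedAddCommGroup G'] [NormedSpace ℝ G']
    (h : IsDavie α a b x g z) (T : G →L[ℝ] G') :
    IsDavie α a b x (fun t => T.comp (g t)) (fun t => T (z t)) := by
  obtain ⟨M, hM0, hM⟩ := h
  refine ⟨‖T‖ * M, by positivity, fun s t h1 h2 h3 => ?_⟩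
  have e : T (z t) - T (z s) - (T.comp (g s)) (x t - x s) = T (z t - z s - g s (x t - x s)) := by
    simp
  rw [e, mul_assoc]
  exact (T.le_opNorm _).trans (mul_le_mul_of_nonneg_left (hM s t h1 h2 h3) (norm_nonneg _))

/-- `x` is `α`-Hölder on `[a, b]`, with a real constant. -/
def HolderBound (α a b : ℝ) (z : ℝ → G) : Prop :=
  ∃ C, 0 ≤ C ∧ ∀ s t, a ≤ s → s ≤ t → t ≤ b → ‖z t - z s‖ ≤ C * (t - s) ^ α

theorem isHolderPath_iff (hα : 0 < α) : IsHolderPath α a b z ↔ HolderBound α a b z := by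
  constructor
  · rintro ⟨C, hC⟩
    refine ⟨C, C.2, fun s t h1 h2 h3 => ?_⟩
    have := hC.dist_le (x := t) (y := s) ⟨h1.trans h2, h3⟩ ⟨h1, h2.trans h3⟩
    rwa [dist_eq_norm, Real.dist_eq, abs_of_nonneg (by linarith), Real.coe_toNNReal _ hα.le] at this
  · rintro ⟨C, hC0, hC⟩
    refine ⟨C.toNNReal, fun s hs t ht => ?_⟩
    have key : dist (z s) (z t) ≤ C * |s - t| ^ α := by
      rcases le_total s t with h | h
      · rw [dist_comm, dist_eq_norm, abs_sub_comm, abs_of_nonneg (by linarith : 0 ≤ t - s)]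
        exact hC s t hs.1 h ht.2
      · rw [dist_eq_norm, abs_of_nonneg (by linarith : 0 ≤ s - t)]
        exact hC t s ht.1 h hs.2
    rw [Real.coe_toNNReal _ hα.le, edist_dist, edist_dist, Real.dist_eq,
      ENNReal.ofReal_rpow_of_nonneg (abs_nonneg _) hα.le]
    rw [show (C.toNNReal : ℝ≥0∞) = ENNReal.ofReal C from rfl, ← ENNReal.ofReal_mul hC0]
    exact ENNReal.ofReal_le_ofReal key

theorem HolderBound.continuousOn (hα : 0 < α) (h : HolderBound α a b z) :
    ContinuousOn z (Icc a b) := by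
  obtain ⟨C, hC⟩ := (isHolderPath_iff hα).2 h
  exact hC.continuousOn (by simpa using hα)

theorem HolderBound.bounded (hα : 0 < α) (h : HolderBound α a b z) :
    ∃ B, 0 ≤ B ∧ ∀ t ∈ Icc a b, ‖z t‖ ≤ B := by
  obtain ⟨B, hB⟩ := isCompact_Icc.exists_bound_of_continuousOn (h.continuousOn hα)
  exact ⟨max B 0, le_max_right _ _, fun t ht => (hB t ht).trans (le_max_left _ _)⟩

/-- Beyond the scale δ the power (t - s)^β is at least δ^β, so there a uniform bound is already a
bound of the required form. -/
theorem exists_bound_of_local {r : ℝ → ℝ → ℝ} {L B δ β : ℝ} (hβ : 0 ≤ β) (hδ : 0 < δ)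
    (hloc : ∀ s t, a ≤ s → s ≤ t → t ≤ b → t - s ≤ δ → r s t ≤ L * (t - s) ^ β)
    (hB : ∀ s t, a ≤ s → s ≤ t → t ≤ b → r s t ≤ B) :
    ∃ M, 0 ≤ M ∧ ∀ s t, a ≤ s → s ≤ t → t ≤ b → r s t ≤ M * (t - s) ^ β := by
  refine ⟨|L| + |B| / δ ^ β, by positivity, fun s t h1 h2 h3 => ?_⟩
  have hp : 0 ≤ (t - s) ^ β := Real.rpow_nonneg (by linarith) _
  have hδβ : 0 < δ ^ β := Real.rpow_pos_of_pos hδ _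
  by_cases h : t - s ≤ δ
  · refine (hloc s t h1 h2 h3 h).trans (mul_le_mul_of_nonneg_right ?_ hp)
    have := le_abs_self L
    have : 0 ≤ |B| / δ ^ β := by positivity
    linarith
  · have e : δ ^ β ≤ (t - s) ^ β := Real.rpow_le_rpow hδ.le (not_le.1 h).le hβ
    calc r s t ≤ |B| := (hB s t h1 h2 h3).trans (le_abs_self B)
      _ = |B| / δ ^ β * δ ^ β := by field_simp
      _ ≤ |B| / δ ^ β * (t - s) ^ β := by gcongr
      _ ≤ _ := mul_le_mul_of_nonneg_right (by linarith [abs_nonneg L]) hp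

theorem IsPartition.le {s t : ℝ} {n : ℕ} {τ : ℕ → ℝ} (h : IsPartition s t n τ) {i j : ℕ}
    (hij : i ≤ j) (hj : j ≤ n) : τ i ≤ τ j := by
  induction j, hij using Nat.le_induction with
  | base => exact le_rfl
  | succ k hk ih => exact (ih (by omega)).trans (h.step_le k (by omega))

theorem IsPartition.mem_Icc {s t : ℝ} {n : ℕ} {τ : ℕ → ℝ} (h : IsPartition s t n τ) {i : ℕ}
    (hi : i ≤ n) : τ i ∈ Icc s t :=
  ⟨h.first ▸ h.le (Nat.zero_le i) hi, h.last ▸ h.le hi le_rfl⟩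

/-- Concatenation of partitions. -/
theorem IsPartition.append {s u t : ℝ} {n k : ℕ} {τ₁ τ₂ : ℕ → ℝ} (h₁ : IsPartition s u n τ₁)
    (h₂ : IsPartition u t k τ₂) :
    ∃ τ, IsPartition s t (n + k) τ ∧ (∀ i ≤ n, τ i = τ₁ i) ∧ ∀ i, τ (n + i) = τ₂ i := by
  set τ : ℕ → ℝ := fun i => if i ≤ n then τ₁ i else τ₂ (i - n) with hτ
  have e₁ : ∀ i ≤ n, τ i = τ₁ i := fun i hi => if_pos hi
  have e₂ : ∀ i, τ (n + i) = τ₂ i := fun i => by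
    rcases Nat.eq_zero_or_pos i with rfl | hi
    · rw [add_zero, e₁ n le_rfl, h₁.last, h₂.first]
    · simp only [hτ]
      rw [if_neg (by omega), Nat.add_sub_cancel_left]
  refine ⟨τ, ⟨by rw [e₁ 0 (Nat.zero_le _), h₁.first], by rw [e₂, h₂.last], fun i hi => ?_⟩, e₁, e₂⟩
  rcases lt_or_ge i n with h | h
  · rw [e₁ _ h.le, e₁ _ h]
    exact h₁.step_le i h
  · obtain ⟨j, rfl⟩ := Nat.exists_eq_add_of_le h
    rw [e₂, add_assoc, e₂]
    exact h₂.step_le j (by omega)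

/-- The increments of z telescope, so the Riemann sum errs by at most M ∑ |τ_{i+1} - τ_i|^(2α) ≤ M
(t - a) mesh^(2α-1), and 2α > 1. -/
theorem IsDavie.hasYoungIntegral (hα : 1 / 2 < α) (h : IsDavie α a b x g z) {t : ℝ}
    (ht : t ∈ Icc a b) : HasYoungIntegral g x a t (z t - z a) := by
  obtain ⟨M, hM0, hM⟩ := h
  intro ε hε
  have hβ : 0 < 2 * α - 1 := by linarith
  -- The added 1 keeps the denominator positive and makes the final inequality strict.
  set η : ℝ := ε / (M * (t - a) + 1) with hη
  have hden : 0 < M * (t - a) + 1 := by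
    have := mul_nonneg hM0 (sub_nonneg.2 ht.1)
    linarith
  have hη0 : 0 < η := by positivity
  refine ⟨η ^ (1 / (2 * α - 1)), by positivity, fun n τ hτ hmesh => ?_⟩
  have hsum : ∀ y : ℝ → G, ∑ i ∈ Finset.range n, (y (τ (i + 1)) - y (τ i)) = y t - y a := by
    intro y
    rw [Finset.sum_range_sub (fun i => y (τ i)), hτ.first, hτ.last]
  have hsum' : ∑ i ∈ Finset.range n, (τ (i + 1) - τ i) = t - a := by
    rw [Finset.sum_range_sub, hτ.first, hτ.last]
  rw [← hsum z, ← Finset.sum_sub_distrib]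
  have hterm : ∀ i ∈ Finset.range n,
      ‖g (τ i) (x (τ (i + 1)) - x (τ i)) - (z (τ (i + 1)) - z (τ i))‖
        ≤ M * (η * (τ (i + 1) - τ i)) := by
    intro i hi
    have hi' := Finset.mem_range.1 hi
    have hle := hτ.step_le i hi'
    have h0 : 0 ≤ τ (i + 1) - τ i := by linarith
    rw [norm_sub_rev]
    refine (hM _ _ (hτ.mem_Icc hi'.le).1 hle
      ((hτ.mem_Icc (Nat.succ_le_of_lt hi')).2.trans ht.2)).trans ?_
    refine mul_le_mul_of_nonneg_left ?_ hM0
    have e1 : (τ (i + 1) - τ i) ^ (2 * α)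
        = (τ (i + 1) - τ i) ^ (2 * α - 1) * (τ (i + 1) - τ i) := by
      conv_rhs => rw [← Real.rpow_one (τ (i + 1) - τ i), ← Real.rpow_mul h0, one_mul]
      rw [← Real.rpow_add_of_nonneg h0 hβ.le zero_le_one]
      congr 1; ring
    have e2 : (τ (i + 1) - τ i) ^ (2 * α - 1) ≤ η := by
      calc _ ≤ (η ^ (1 / (2 * α - 1))) ^ (2 * α - 1) :=
            Real.rpow_le_rpow h0 (hmesh i hi').le hβ.le
        _ = η := by
            rw [← Real.rpow_mul hη0.le, one_div, inv_mul_cancel₀ hβ.ne', Real.rpow_one]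
    rw [e1]
    exact mul_le_mul_of_nonneg_right e2 h0
  refine (norm_sum_le_of_le _ hterm).trans_lt ?_
  rw [← Finset.mul_sum, ← Finset.mul_sum, hsum']
  calc M * (η * (t - a)) = ε * (M * (t - a)) / (M * (t - a) + 1) := by rw [hη]; ring
    _ < ε := by rw [div_lt_iff₀ hden]; nlinarith

/-- Young's estimate for the increments of an integral path. -/
theorem isDavie_of_hasYoungIntegral (hα : 1 / 2 < α) (hx : HolderBound α a b x)
    (hg : HolderBound α a b g) {z₀ : G}
    (h : ∀ t ∈ Icc a b, HasYoungIntegral g x a t (z t - z₀)) : IsDavie α a b x g z := by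
  obtain ⟨C, hC0, hC⟩ := hx
  obtain ⟨C', hC0', hC'⟩ := hg
  have hθ : 1 < 2 * α := by linarith
  have hsc := sewingConst_pos hθ
  refine ⟨sewingConst (2 * α) * (C' * C), by positivity, fun s t hs hst ht => ?_⟩
  refine le_of_forall_pos_le_add fun η hη => ?_
  obtain ⟨δ₁, hδ₁, H₁⟩ := h s ⟨hs, hst.trans ht⟩ (η / 2) (by positivity)
  obtain ⟨δ₂, hδ₂, H₂⟩ := h t ⟨hs.trans hst, ht⟩ (η / 2) (by positivity)
  obtain ⟨n, hn⟩ := exists_nat_gt ((b - a) / min δ₁ δ₂)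
  have hab : a ≤ b := hs.trans (hst.trans ht)
  have hδ : 0 < min δ₁ δ₂ := lt_min hδ₁ hδ₂
  have hn0 : (0 : ℝ) < n := (div_nonneg (by linarith) hδ.le).trans_lt hn
  have hn0' : n ≠ 0 := by exact_mod_cast hn0.ne'
  have hmesh : ∀ u ≤ b - a, u / n < min δ₁ δ₂ := by
    intro u hu
    rw [div_lt_iff₀ hδ] at hn
    rw [div_lt_iff₀ hn0]
    linarith
  -- Only integrals starting at a are given. The increment of z over [s, t] is therefore read off by
  -- comparing a partition of [a, s] with its extension to a partition of [a, t]; the difference is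
  -- a Riemann sum over [s, t].
  set σ₁ := uniformPoint a s n with hσ₁
  set σ₂ := uniformPoint s t n with hσ₂
  have m₁ : Monotone σ₁ := uniformPoint_monotone hs n
  have m₂ : Monotone σ₂ := uniformPoint_monotone hst n
  have l₁ : σ₁ n = s := uniformPoint_last a s hn0'
  have l₂ : σ₂ n = t := uniformPoint_last s t hn0'
  have P₁ : IsPartition a s n σ₁ := ⟨uniformPoint_zero _ _ _, l₁, fun i _ => m₁ (Nat.le_succ i)⟩
  have P₂ : IsPartition s t n σ₂ := ⟨uniformPoint_zero _ _ _, l₂, fun i _ => m₂ (Nat.le_succ i)⟩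
  obtain ⟨τ, P, τ₁, τ₂⟩ := P₁.append P₂
  have step : ∀ i < n + n, (τ i = σ₁ i ∧ τ (i + 1) = σ₁ (i + 1)) ∨
      (τ i = σ₂ (i - n) ∧ τ (i + 1) = σ₂ (i - n + 1)) := by
    intro i hi
    rcases lt_or_ge i n with h | h
    · exact Or.inl ⟨τ₁ _ h.le, τ₁ _ h⟩
    · obtain ⟨j, rfl⟩ := Nat.exists_eq_add_of_le h
      right
      rw [τ₂, Nat.add_sub_cancel_left, add_assoc, τ₂]
      exact ⟨rfl, rfl⟩
  have q₁ := H₁ n σ₁ P₁ fun i _ => by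
    rw [uniformPoint_succ_sub]
    exact (hmesh _ (by linarith)).trans_le (min_le_left _ _)
  have q₂ := H₂ (n + n) τ P fun i hi => by
    rcases step i hi with h | h <;> rw [h.1, h.2, uniformPoint_succ_sub] <;>
      exact (hmesh _ (by linarith)).trans_le (min_le_right _ _)
  rw [Finset.sum_range_add, Finset.sum_congr rfl (fun i hi => by
    rw [τ₁ _ (Finset.mem_range.1 hi).le, τ₁ _ (Nat.succ_le_of_lt (Finset.mem_range.1 hi))])] at q₂
  simp only [add_assoc, τ₂] at q₂
  set S₁ := ∑ i ∈ Finset.range n, g (σ₁ i) (x (σ₁ (i + 1)) - x (σ₁ i)) with hS₁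
  set S₂ := ∑ i ∈ Finset.range n, g (σ₂ i) (x (σ₂ (i + 1)) - x (σ₂ i)) with hS₂
  have in₂ : ∀ i ≤ n, a ≤ σ₂ i ∧ σ₂ i ≤ b := fun i hi =>
    ⟨hs.trans (P₂.mem_Icc hi).1, (P₂.mem_Icc hi).2.trans ht⟩
  have hS : ‖S₂ - g s (x t - x s)‖ ≤ sewingConst (2 * α) * (C' * C) * (t - s) ^ (2 * α) := by
    -- The sewing is applied to Riemann sum minus germ, with elapsed time as control. This vanishes
    -- between neighbouring points, so only the control term survives, with a constant independent
    -- of n.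
    have hctl : IsControlOn (fun i j => σ₂ j - σ₂ i) 0 n :=
      ⟨fun i j _ h _ => sub_nonneg.2 (m₂ h), fun i j k _ _ _ _ => by linarith⟩
    have := discrete_sewing (m := 0) (n := n) (R := fun i j =>
        ‖∑ k ∈ Finset.Ico i j, g (σ₂ k) (x (σ₂ (k + 1)) - x (σ₂ k)) - g (σ₂ i) (x (σ₂ j) - x (σ₂ i))‖)
      (K := C' * C) hθ (by positivity) (Nat.zero_le _) hctl (fun i => by simp) ?_
    · simp only [Nat.Ico_succ_singleton, Finset.sum_singleton, sub_self, norm_zero,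
        Finset.sum_const_zero, zero_add, l₂, P₂.first, Nat.Ico_zero_eq_range] at this
      exact this
    · intro i j k _ hij hjk hk
      have e : ∑ l ∈ Finset.Ico i k, g (σ₂ l) (x (σ₂ (l + 1)) - x (σ₂ l))
            - g (σ₂ i) (x (σ₂ k) - x (σ₂ i))
          = (∑ l ∈ Finset.Ico i j, g (σ₂ l) (x (σ₂ (l + 1)) - x (σ₂ l))
              - g (σ₂ i) (x (σ₂ j) - x (σ₂ i)))
            + (∑ l ∈ Finset.Ico j k, g (σ₂ l) (x (σ₂ (l + 1)) - x (σ₂ l))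
              - g (σ₂ j) (x (σ₂ k) - x (σ₂ j)))
            + (g (σ₂ j) - g (σ₂ i)) (x (σ₂ k) - x (σ₂ j)) := by
        rw [← Finset.sum_Ico_consecutive _ hij hjk]
        simp only [map_sub, sub_apply]
        abel
      rw [e]
      refine (norm_add_le _ _).trans (add_le_add (norm_add_le _ _) ?_)
      have hα0 : 0 ≤ α := by linarith
      have d1 : 0 ≤ σ₂ j - σ₂ i := sub_nonneg.2 (m₂ hij)
      have d2 : 0 ≤ σ₂ k - σ₂ j := sub_nonneg.2 (m₂ hjk)
      have b1 := hC' (σ₂ i) (σ₂ j) (in₂ i (by omega)).1 (m₂ hij) (in₂ j (by omega)).2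
      have b2 := hC (σ₂ j) (σ₂ k) (in₂ j (by omega)).1 (m₂ hjk) (in₂ k (by omega)).2
      have r1 : (σ₂ j - σ₂ i) ^ α ≤ (σ₂ k - σ₂ i) ^ α :=
        Real.rpow_le_rpow d1 (by linarith) hα0
      have r2 : (σ₂ k - σ₂ j) ^ α ≤ (σ₂ k - σ₂ i) ^ α :=
        Real.rpow_le_rpow d2 (by linarith) hα0
      calc _ ≤ ‖g (σ₂ j) - g (σ₂ i)‖ * ‖x (σ₂ k) - x (σ₂ j)‖ := ContinuousLinearMap.le_opNorm _ _
        _ ≤ (C' * (σ₂ k - σ₂ i) ^ α) * (C * (σ₂ k - σ₂ i) ^ α) := by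
            refine mul_le_mul (b1.trans (by gcongr)) (b2.trans (by gcongr)) (norm_nonneg _) ?_
            have : 0 ≤ (σ₂ k - σ₂ i) ^ α := Real.rpow_nonneg (by linarith) _
            positivity
        _ = _ := by
            rw [two_mul, Real.rpow_add_of_nonneg (by linarith) hα0 hα0]; ring
  have e : z t - z s - g s (x t - x s) = (S₁ - (z s - z₀)) - (S₁ + S₂ - (z t - z₀))
      + (S₂ - g s (x t - x s)) := by abel
  rw [e]
  have n1 := norm_add_le ((S₁ - (z s - z₀)) - (S₁ + S₂ - (z t - z₀))) (S₂ - g s (x t - x s))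
  have n2 := norm_sub_le (S₁ - (z s - z₀)) (S₁ + S₂ - (z t - z₀))
  linarith

end Davie

/-! ### Existence of solutions by Euler schemes -/

/-- `x` has finite `1 / α`-variation on `[a, b]` controlled by `ω`, where `ω s t` is comparable to
`t - s`. -/
structure IsDriver {F : Type*} [NormedAddCommGroup F] (α a b : ℝ) (x : ℝ → F) (ω : ℝ → ℝ → ℝ) :
    Prop where
  control : IsControlOn ω a b
  sub_le : ∀ s t, a ≤ s → s ≤ t → t ≤ b → t - s ≤ ω s t
  le_mul_sub : ∃ C, 0 < C ∧ ∀ s t, a ≤ s → s ≤ t → t ≤ b → ω s t ≤ C * (t - s)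
  norm_sub_le : ∀ s t, a ≤ s → s ≤ t → t ≤ b → ‖x t - x s‖ ≤ ω s t ^ α

section

variable {F G : Type*} [NormedAddCommGroup F] [NormedSpace ℝ F] [NormedAddCommGroup G]
  [NormedSpace ℝ G] {x : ℝ → F} {z : ℝ → G} {g : ℝ → F →L[ℝ] G} {α a b : ℝ}

theorem IsDriver.holderBound {ω : ℝ → ℝ → ℝ} (hα : 0 < α) (h : IsDriver α a b x ω) :
    HolderBound α a b x := by
  obtain ⟨C, hC0, hC⟩ := h.le_mul_sub
  refine ⟨C ^ α, by positivity, fun s t h1 h2 h3 => ?_⟩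
  rw [← Real.mul_rpow hC0.le (by linarith)]
  exact (h.norm_sub_le s t h1 h2 h3).trans
    (Real.rpow_le_rpow (h.control.nonneg s t h1 h2 h3) (hC s t h1 h2 h3) hα.le)

/-- The local a priori estimate for paths. -/
theorem IsDriver.local_estimate {ω : ℝ → ℝ → ℝ} (hd : IsDriver α a b x ω) (hα : 1 / 2 < α)
    (hz : IsDavie α a b x g z) (hzb : ∃ Z, ∀ t ∈ Icc a b, ‖z t‖ ≤ Z) {A B s₀ t₀ : ℝ} (hA : 0 ≤ A)
    (hB : 0 ≤ B) (has₀ : a ≤ s₀) (hst₀ : s₀ ≤ t₀) (htb₀ : t₀ ≤ b)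
    (hsmall : 2 * localConst α A * ω s₀ t₀ ^ α ≤ 1)
    (hg : ∀ s, s₀ ≤ s → s ≤ t₀ → ‖g s‖ ≤ A * ‖z s‖ + B)
    (hgd : ∀ s t, s₀ ≤ s → s ≤ t → t ≤ t₀ →
      ‖g t - g s‖ ≤ A * ‖z t - z s‖ + (A * max ‖z s‖ ‖z t‖ + B) * ω s t ^ α) :
    (∀ t, s₀ ≤ t → t ≤ t₀ → ‖z t‖ ≤ 2 * ‖z s₀‖ + B) ∧
    (∀ s t, s₀ ≤ s → s ≤ t → t ≤ t₀ → ‖z t - z s - g s (x t - x s)‖ ≤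
      localConst α A * (‖z s₀‖ + B) * ω s t ^ (2 * α)) ∧
    (∀ s t, s₀ ≤ s → s ≤ t → t ≤ t₀ → ‖z t - z s‖ ≤
      localConst α A * (‖z s₀‖ + B) * ω s t ^ α) := by
  obtain ⟨M, hM0, hM⟩ := hz
  obtain ⟨Z, hZ⟩ := hzb
  have hω := hd.control.subinterval has₀ htb₀
  refine YoungEq.local_estimate hα hA hB hst₀ hω hsmall
    (fun s t h1 h2 h3 => hd.norm_sub_le s t (has₀.trans h1) h2 (h3.trans htb₀)) hg hgd
    (fun K hK h s t h1 h2 h3 => ?_) (M₀ := M) (fun s t h1 h2 h3 => ?_)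
    (Z₀ := Z) (fun s h1 h2 => hZ s ⟨has₀.trans h1, h2.trans htb₀⟩)
  · refine real_sewing (R := fun s t => ‖z t - z s - g s (x t - x s)‖) (M := M) (by linarith) hK hω
      (remainder_self x z g) (fun s u t h1 h2 h3 h4 => ?_)
      (fun s t h1 h2 h3 => hM s t (has₀.trans h1) h2 (h3.trans htb₀)) h1 h2 h3
    exact (remainder_triangle x z g s u t).trans (add_le_add_right (h s u t h1 h2 h3 h4) _)
  · refine (hM s t (has₀.trans h1) h2 (h3.trans htb₀)).trans (mul_le_mul_of_nonneg_left ?_ hM0)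
    exact Real.rpow_le_rpow (by linarith) (hd.sub_le s t (has₀.trans h1) h2 (h3.trans htb₀))
      (by linarith)

/-- Davie's estimates for the Euler scheme. -/
theorem euler_estimate {f : G → F →L[ℝ] G} {K : ℝ} (hα : 1 / 2 < α) (hK : 0 ≤ K)
    (hf : ∀ y, ‖f y‖ ≤ K) (hfl : ∀ y y', ‖f y - f y'‖ ≤ K * ‖y - y'‖) {p : ℕ → F} {Y : ℕ → G}
    (hY : ∀ k, Y (k + 1) = Y k + f (Y k) (p (k + 1) - p k)) {ω : ℕ → ℕ → ℝ} {i j : ℕ} (hij : i ≤ j)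
    (hω : IsControlOn ω i j) (hpos : ∀ s t, i ≤ s → s < t → t ≤ j → 0 < ω s t)
    (hsmall : 2 * localConst α K * ω i j ^ α ≤ 1)
    (hp : ∀ s t, i ≤ s → s ≤ t → t ≤ j → ‖p t - p s‖ ≤ ω s t ^ α) :
    ‖Y j - Y i - f (Y i) (p j - p i)‖ ≤ localConst α K * K * ω i j ^ (2 * α) ∧
      ‖Y j - Y i‖ ≤ localConst α K * K * ω i j ^ α := by
  have hω0 : ∀ s t, i ≤ s → s ≤ t → t ≤ j → 0 ≤ ω s t := hω.nonneg
  have hsub : ∀ s t, Y t - Y i - (Y s - Y i) = Y t - Y s := fun s t => by abel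
  -- The shifted scheme Y - Y i starts from zero, so the initial value disappears from the bounds.
  -- The crude constants M₀ and Z₀ are sums over the finitely many indices; dividing by the control
  -- is legitimate because it is positive off the diagonal.
  have := local_estimate (x := p) (z := fun k => Y k - Y i) (g := fun k => f (Y k)) (A := K) (B := K)
    (M₀ := ∑ q ∈ Finset.range (j + 1) ×ˢ Finset.range (j + 1),
      ‖Y q.2 - Y q.1 - f (Y q.1) (p q.2 - p q.1)‖ / |ω q.1 q.2| ^ (2 * α))
    (Z₀ := ∑ q ∈ Finset.range (j + 1), ‖Y q - Y i‖)
    hα hK hK hij hω hsmall hp (fun s _ _ => (hf _).trans (le_add_of_nonneg_left (by positivity)))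
    (fun s t h1 h2 h3 => ?_) (fun K' hK' h s t h1 h2 h3 => ?_) (fun s t h1 h2 h3 => ?_)
    (fun s h1 h2 => ?_)
  · have e1 := this.2.1 i j le_rfl hij le_rfl
    have e2 := this.2.2 i j le_rfl hij le_rfl
    simp only [sub_self, norm_zero, zero_add, sub_zero] at e1 e2
    exact ⟨e1, e2⟩
  · simp only [hsub]
    have := Real.rpow_nonneg (hω0 s t h1 h2 h3) α
    exact (hfl _ _).trans (le_add_of_nonneg_right (by positivity))
  · simp only [hsub]
    -- An Euler step has zero remainder, so the sum over neighbouring points drops out.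
    have := discrete_sewing (m := s) (n := t) (K := K')
      (R := fun s t => ‖Y t - Y s - f (Y s) (p t - p s)‖)
      (show 1 < 2 * α by linarith) hK' h2 (hω.subinterval h1 h3)
      (remainder_self p Y fun k => f (Y k)) (fun a b c h4 h5 h6 h7 => ?_)
    · refine this.trans (le_of_eq ?_)
      simp [hY]
    · exact (remainder_triangle p Y (fun k => f (Y k)) a b c).trans
        (add_le_add_right (h a b c (h1.trans h4) h5 h6 (h7.trans h3)) _)
  · simp only [hsub]
    rcases h2.eq_or_lt with rfl | hlt
    · have := Real.rpow_nonneg (hω0 s s h1 h2 h3) (2 * α)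
      simp only [sub_self, map_zero, norm_zero]
      positivity
    · have hw := hpos s t h1 hlt h3
      have := Finset.single_le_sum (s := Finset.range (j + 1) ×ˢ Finset.range (j + 1))
        (f := fun q => ‖Y q.2 - Y q.1 - f (Y q.1) (p q.2 - p q.1)‖ / |ω q.1 q.2| ^ (2 * α))
        (fun q _ => by positivity) (a := (s, t)) (by simp; omega)
      simp only [abs_of_pos hw] at this
      rwa [div_le_iff₀ (Real.rpow_pos_of_pos hw _)] at this
  · exact Finset.single_le_sum (s := Finset.range (j + 1)) (f := fun q => ‖Y q - Y i‖)
      (fun q _ => norm_nonneg _) (by simp; omega)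

/-- The Euler scheme along the points `p 0, p 1, …`. -/
noncomputable def eulerScheme (f : G → F →L[ℝ] G) (y₀ : G) (p : ℕ → F) : ℕ → G
  | 0 => y₀
  | k + 1 => eulerScheme f y₀ p k + f (eulerScheme f y₀ p k) (p (k + 1) - p k)

/-- One fixed ultrafilter selects limits at all times simultaneously, which replaces the
Arzelà–Ascoli theorem or a diagonal subsequence. -/
theorem exists_tendsto_hyperfilter [FiniteDimensional ℝ G] {u : ℕ → G} {B : ℝ}
    (h : ∀ᶠ n in atTop, ‖u n‖ ≤ B) : ∃ l, Tendsto u (hyperfilter ℕ) (𝓝 l) ∧ ‖l‖ ≤ B := by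
  have : ProperSpace G := FiniteDimensional.proper ℝ G
  obtain ⟨l, hl, hl'⟩ := (isCompact_closedBall (0 : G) B).ultrafilter_le_nhds
    ((hyperfilter ℕ).map u) (by
      rw [le_principal_iff]
      refine Nat.hyperfilter_le_atTop ?_
      filter_upwards [h] with n hn
      simpa using hn)
  exact ⟨l, hl', by simpa using hl⟩

theorem exists_small_rpow {L : ℝ} (hα : 0 < α) (hL : 0 < L) :
    ∃ ε, 0 < ε ∧ ∀ w, 0 ≤ w → w ≤ ε → 2 * L * w ^ α ≤ 1 := by
  refine ⟨(1 / (2 * L)) ^ (1 / α), by positivity, fun w hw hwε => ?_⟩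
  have := Real.rpow_le_rpow hw hwε hα.le
  rw [← Real.rpow_mul (by positivity), one_div_mul_cancel hα.ne', Real.rpow_one] at this
  rw [le_div_iff₀ (by positivity)] at this
  linarith

/-- Euler schemes of step 1/(n + 1) satisfy the local estimates with constants independent of n.
They are therefore bounded on [a, b], and the estimates, being closed conditions, pass to the
ultrafilter limit by continuity of f and x. The Hölder bound is assumed on all of ℝ so that grid
points beyond b need no separate treatment. -/
theorem exists_davie_of_global [FiniteDimensional ℝ G] {f : G → F →L[ℝ] G} {K c : ℝ}
    (hα : 1 / 2 < α) (hK : 0 ≤ K) (hf : ∀ y, ‖f y‖ ≤ K)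
    (hfl : ∀ y y', ‖f y - f y'‖ ≤ K * ‖y - y'‖) (hc : 0 < c)
    (hx : ∀ s t, s ≤ t → ‖x t - x s‖ ≤ (c * (t - s)) ^ α) (hab : a ≤ b) (y₀ : G) :
    ∃ y : ℝ → G, y a = y₀ ∧ HolderBound α a b y ∧ IsDavie α a b x (fun t => f (y t)) y := by
  have hα0 : 0 < α := by linarith
  have hL := localConst_ge_one hα hK
  set L := localConst α K with hLdef
  obtain ⟨ε₀, hε₀, hsm⟩ := exists_small_rpow hα0 (show 0 < L by linarith)
  set ε := ε₀ / c with hε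
  have hε0 : 0 < ε := by positivity
  have hcε : c * ε = ε₀ := by rw [hε]; field_simp
  have hxc : Continuous x := by
    rw [continuous_iff_continuousAt]
    intro t
    have hb : ∀ s, ‖x s - x t‖ ≤ (c * |s - t|) ^ α := fun s => by
      rcases le_total s t with h | h
      · rw [norm_sub_rev, abs_sub_comm, abs_of_nonneg (by linarith : 0 ≤ t - s)]; exact hx s t h
      · rw [abs_of_nonneg (by linarith : 0 ≤ s - t)]; exact hx t s h
    rw [ContinuousAt, tendsto_iff_norm_sub_tendsto_zero]
    refine squeeze_zero (fun _ => norm_nonneg _) hb ?_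
    have : Continuous fun s => (c * |s - t|) ^ α :=
      (by fun_prop : Continuous fun s => c * |s - t|).rpow_const fun _ => Or.inr hα0.le
    simpa [Real.zero_rpow hα0.ne'] using this.tendsto t
  have hfc : Continuous f := by
    have : LipschitzWith K.toNNReal f := LipschitzWith.of_dist_le_mul fun y y' => by
      rw [dist_eq_norm, dist_eq_norm, Real.coe_toNNReal _ hK]; exact hfl y y'
    exact this.continuous
  set P : ℕ → ℕ → ℝ := fun n j => a + j / ((n : ℝ) + 1) with hP
  set Y : ℕ → ℕ → G := fun n => eulerScheme f y₀ fun j => x (P n j) with hY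
  have hPsub : ∀ n i j, P n j - P n i = (j - i : ℝ) / (n + 1) := fun n i j => by
    simp only [hP]; ring
  have hPm : ∀ n, StrictMono (P n) := fun n i j h => by
    have h1 : (i : ℝ) < j := by exact_mod_cast h
    have h2 : 0 < P n j - P n i := by
      rw [hPsub]
      exact div_pos (by linarith) (by positivity)
    linarith
  have hest : ∀ n i j, i ≤ j → P n j - P n i ≤ ε →
      ‖Y n j - Y n i - f (Y n i) (x (P n j) - x (P n i))‖
          ≤ L * K * (c * (P n j - P n i)) ^ (2 * α) ∧
        ‖Y n j - Y n i‖ ≤ L * K * (c * (P n j - P n i)) ^ α := by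
    intro n i j hij h
    have h0 : 0 ≤ P n j - P n i := sub_nonneg.2 ((hPm n).monotone hij)
    refine euler_estimate (p := fun j => x (P n j)) (ω := fun i j => c * (P n j - P n i)) hα hK hf
      hfl (fun k => rfl) hij ⟨fun s t _ h _ => ?_, fun s u t _ _ _ _ => ?_⟩ (fun s t _ h _ => ?_)
      (hsm _ (by positivity) ?_) (fun s t _ h _ => hx _ _ ((hPm n).monotone h))
    · have : 0 ≤ P n t - P n s := sub_nonneg.2 ((hPm n).monotone h)
      positivity
    · exact le_of_eq (by ring)
    · have : 0 < P n t - P n s := sub_pos.2 (hPm n h)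
      positivity
    · rw [← hcε]; gcongr
  have hstep : ∀ n i j, i ≤ j → P n j - P n i ≤ ε → ‖Y n j - Y n i‖ ≤ K := by
    intro n i j hij h
    refine (hest n i j hij h).2.trans ?_
    have h0 : 0 ≤ P n j - P n i := sub_nonneg.2 ((hPm n).monotone hij)
    have h1 : c * (P n j - P n i) ≤ ε₀ := by rw [← hcε]; gcongr
    have h2 := hsm _ (by positivity) h1
    have h3 : 0 ≤ (c * (P n j - P n i)) ^ α := Real.rpow_nonneg (by positivity) _
    nlinarith
  have hbound : ∀ n : ℕ, 1 / ((n : ℝ) + 1) ≤ ε / 2 → ∀ k j : ℕ, P n j - a ≤ k * (ε / 2) →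
      ‖Y n j - y₀‖ ≤ k * K := by
    intro n hn k
    have hn0 : (0 : ℝ) < (n : ℝ) + 1 := by positivity
    induction k with
    | zero =>
      intro j hj
      have : P n j ≤ P n 0 := by simp only [hP]; simp only [hP] at hj; simp at hj ⊢; linarith
      have : j = 0 := by
        by_contra h
        exact absurd (hPm n (Nat.pos_of_ne_zero h)) (not_lt.2 this)
      subst this
      simp [hY, eulerScheme]
    | succ k ih =>
      intro j hj
      -- Going back l + 1 grid points moves by more than ε/2, which uses up one window of the
      -- induction. As the mesh is at most ε/2, it moves by no more than ε, so the local estimate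
      -- applies.
      set l := ⌊(ε / 2) * ((n : ℝ) + 1)⌋₊ with hl
      have l1 : (l : ℝ) ≤ (ε / 2) * (n + 1) := Nat.floor_le (by positivity)
      have l2 : (ε / 2) * (n + 1) < l + 1 := Nat.lt_floor_add_one _
      have hi1 : P n j - P n (j - (l + 1)) ≤ ε := by
        rw [hPsub]
        have e1 : (j : ℝ) - ((j - (l + 1) : ℕ) : ℝ) ≤ l + 1 := by
          have : j ≤ (j - (l + 1)) + (l + 1) := by omega
          have : (j : ℝ) ≤ ((j - (l + 1) : ℕ) : ℝ) + (l + 1) := by exact_mod_cast this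
          linarith
        rw [div_le_iff₀ hn0] at hn ⊢
        linarith
      have hi2 : P n (j - (l + 1)) - a ≤ k * (ε / 2) := by
        rcases le_or_gt j (l + 1) with h | h
        · rw [Nat.sub_eq_zero_of_le h]
          simp only [hP]; simp; positivity
        · simp only [hP] at hj ⊢
          rw [Nat.cast_sub h.le]
          rw [add_sub_cancel_left, div_le_iff₀ hn0] at hj ⊢
          push_cast at hj ⊢
          nlinarith
      have h1 := hstep n _ j (Nat.sub_le _ _) hi1
      have h2 := ih _ hi2
      have h3 := norm_add_le (Y n j - Y n (j - (l + 1))) (Y n (j - (l + 1)) - y₀)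
      rw [sub_add_sub_cancel] at h3
      push_cast
      linarith
  -- For t ≥ a, the index of the last grid point not after t.
  set N : ℕ → ℝ → ℕ := fun n t => ⌊(t - a) * ((n : ℝ) + 1)⌋₊ with hN
  have hNm : ∀ n s t, s ≤ t → N n s ≤ N n t := fun n s t h =>
    Nat.floor_le_floor (by gcongr)
  have hPN : ∀ t, a ≤ t → Tendsto (fun n => P n (N n t)) atTop (𝓝 t) := by
    intro t ht
    have h1 := (tendsto_nat_floor_mul_div_atTop (R := ℝ) (show 0 ≤ t - a by linarith)).comp
      (tendsto_natCast_atTop_atTop.comp (tendsto_add_atTop_nat 1))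
    have h2 := h1.const_add a
    rw [add_sub_cancel] at h2
    refine h2.congr fun n => ?_
    simp [hP, hN]
  have hPN' : ∀ n t, a ≤ t → P n (N n t) ≤ t := fun n t ht => by
    have : (N n t : ℝ) ≤ (t - a) * (n + 1) :=
      Nat.floor_le (mul_nonneg (by linarith) (by positivity))
    have h2 : (N n t : ℝ) / (n + 1) ≤ t - a := by rwa [div_le_iff₀ (by positivity)]
    simp only [hP]; linarith
  obtain ⟨k, hk⟩ := exists_nat_ge ((b - a) / (ε / 2))
  rw [div_le_iff₀ (by positivity)] at hk
  have hev : ∀ᶠ n : ℕ in atTop, 1 / ((n : ℝ) + 1) ≤ ε / 2 :=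
    (tendsto_one_div_add_atTop_nhds_zero_nat.eventually (eventually_lt_nhds (by positivity))).mono
      fun n hn => hn.le
  have hlim : ∀ t, ∃ l, t ∈ Icc a b → Tendsto (fun n => Y n (N n t)) (hyperfilter ℕ) (𝓝 l) ∧
      ‖l‖ ≤ k * K + ‖y₀‖ := by
    intro t
    by_cases ht : t ∈ Icc a b
    swap
    · exact ⟨0, fun h => absurd h ht⟩
    obtain ⟨l, hl⟩ := exists_tendsto_hyperfilter (u := fun n => Y n (N n t)) (B := k * K + ‖y₀‖) (by
      filter_upwards [hev] with n hn
      have h1 := hbound n hn k (N n t) (by have := hPN' n t ht.1; linarith [ht.2])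
      have h2 := norm_add_le (Y n (N n t) - y₀) y₀
      rw [sub_add_cancel] at h2
      linarith)
    exact ⟨l, fun _ => hl⟩
  choose y hy using hlim
  have hU : (hyperfilter ℕ : Filter ℕ) ≤ atTop := Nat.hyperfilter_le_atTop
  have hloc : ∀ s t, a ≤ s → s ≤ t → t ≤ b → t - s ≤ ε / 2 →
      ‖y t - y s - f (y s) (x t - x s)‖ ≤ L * K * c ^ (2 * α) * (t - s) ^ (2 * α) ∧
      ‖y t - y s‖ ≤ L * K * c ^ α * (t - s) ^ α := by
    intro s t hs hst ht h
    have ps := (hPN s hs).mono_left hU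
    have pt := (hPN t (hs.trans hst)).mono_left hU
    have ys := (hy s ⟨hs, hst.trans ht⟩).1
    have yt := (hy t ⟨hs.trans hst, ht⟩).1
    have hsm' : ∀ᶠ n in (hyperfilter ℕ : Filter ℕ), P n (N n t) - P n (N n s) ≤ ε :=
      ((pt.sub ps).eventually (eventually_lt_nhds (by linarith : t - s < ε))).mono
        fun n hn => hn.le
    have hrhs : ∀ β : ℝ, 0 < β → Tendsto (fun n => L * K * (c * (P n (N n t) - P n (N n s))) ^ β)
        (hyperfilter ℕ) (𝓝 (L * K * c ^ β * (t - s) ^ β)) := by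
      intro β hβ
      rw [mul_assoc, ← Real.mul_rpow hc.le (by linarith : 0 ≤ t - s)]
      exact (((pt.sub ps).const_mul c).rpow_const (Or.inr hβ.le)).const_mul _
    have hfys : Tendsto (fun n => f (Y n (N n s))) (hyperfilter ℕ) (𝓝 (f (y s))) :=
      (hfc.tendsto _).comp ys
    have hxst : Tendsto (fun n => x (P n (N n t)) - x (P n (N n s))) (hyperfilter ℕ)
        (𝓝 (x t - x s)) := ((hxc.tendsto _).comp pt).sub ((hxc.tendsto _).comp ps)
    constructor
    · have hl : Tendsto (fun n => ‖Y n (N n t) - Y n (N n s)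
          - f (Y n (N n s)) (x (P n (N n t)) - x (P n (N n s)))‖) (hyperfilter ℕ)
          (𝓝 ‖y t - y s - f (y s) (x t - x s)‖) :=
        ((yt.sub ys).sub
          ((isBoundedBilinearMap_apply.continuous.tendsto (f (y s), x t - x s)).comp
            (hfys.prodMk_nhds hxst))).norm
      refine le_of_tendsto_of_tendsto hl (hrhs _ (by linarith)) ?_
      filter_upwards [hsm'] with n hn
      exact (hest n _ _ (hNm n s t hst) hn).1
    · refine le_of_tendsto_of_tendsto (yt.sub ys).norm (hrhs _ hα0) ?_
      filter_upwards [hsm'] with n hn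
      exact (hest n _ _ (hNm n s t hst) hn).2
  have hyb : ∀ t, a ≤ t → t ≤ b → ‖y t‖ ≤ k * K + ‖y₀‖ := fun t h1 h2 => (hy t ⟨h1, h2⟩).2
  have hyd : ∀ s t, a ≤ s → s ≤ t → t ≤ b → ‖y t - y s‖ ≤ 2 * (k * K + ‖y₀‖) :=
    fun s t h1 h2 h3 => by
      have := norm_sub_le (y t) (y s)
      linarith [hyb s h1 (h2.trans h3), hyb t (h1.trans h2) h3]
  have hH : HolderBound α a b y := exists_bound_of_local hα0.le (by positivity)
    (fun s t h1 h2 h3 h4 => (hloc s t h1 h2 h3 h4).2) hyd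
  refine ⟨y, ?_, hH, ?_⟩
  · have h1 := (hy a ⟨le_rfl, hab⟩).1
    have h2 : (fun n => Y n (N n a)) = fun _ => y₀ := by
      funext n; simp [hN, hY, eulerScheme]
    rw [h2] at h1
    exact tendsto_nhds_unique h1 tendsto_const_nhds
  · refine exists_bound_of_local (B := 2 * (k * K + ‖y₀‖) + K * (c * (b - a)) ^ α)
      (by linarith) (by positivity) (fun s t h1 h2 h3 h4 => (hloc s t h1 h2 h3 h4).1)
      fun s t h1 h2 h3 => ?_
    refine (norm_sub_le _ _).trans (add_le_add (hyd s t h1 h2 h3) ?_)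
    refine ((f (y s)).le_opNorm _).trans
      (mul_le_mul (hf _) ((hx s t h2).trans ?_) (norm_nonneg _) hK)
    have : 0 ≤ t - s := by linarith
    exact Real.rpow_le_rpow (by positivity) (by gcongr) hα0.le

/-- Existence of solutions of Young equations with a bounded Lipschitz coefficient. -/
theorem exists_davie [FiniteDimensional ℝ G] {f : G → F →L[ℝ] G} {K : ℝ}
    (hα : 1 / 2 < α) (hK : 0 ≤ K) (hf : ∀ y, ‖f y‖ ≤ K)
    (hfl : ∀ y y', ‖f y - f y'‖ ≤ K * ‖y - y'‖) (hx : HolderBound α a b x) (hab : a ≤ b) (y₀ : G) :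
    ∃ y : ℝ → G, y a = y₀ ∧ HolderBound α a b y ∧ IsDavie α a b x (fun t => f (y t)) y := by
  obtain ⟨C, hC0, hC⟩ := hx
  have hα0 : 0 < α := by linarith
  -- Clamping time to [a, b] is monotone and does not increase distances, so x ∘ κ is a Hölder
  -- extension of x to ℝ. The 1 added to C^(1/α) below makes the constant positive.
  set κ : ℝ → ℝ := fun t => max a (min b t) with hκ
  have hκ1 : ∀ t ∈ Icc a b, κ t = t := fun t ht => by
    simp only [hκ]; rw [min_eq_right ht.2, max_eq_right ht.1]
  have hκ2 : ∀ s t, s ≤ t → κ s ≤ κ t := fun s t h => by simp only [hκ]; gcongr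
  have hκ3 : ∀ s t, s ≤ t → κ t - κ s ≤ t - s := fun s t h => by
    simp only [hκ]
    rcases max_cases a (min b t) with h1 | h1 <;> rcases max_cases a (min b s) with h2 | h2 <;>
      rcases min_cases b t with h3 | h3 <;> rcases min_cases b s with h4 | h4 <;> linarith
  have hκx : ∀ s t, s ≤ t → ‖x (κ t) - x (κ s)‖ ≤ ((C ^ (1 / α) + 1) * (t - s)) ^ α := by
    intro s t hst
    have h0 : 0 ≤ t - s := by linarith
    have h1 := hC (κ s) (κ t) (le_max_left _ _) (hκ2 s t hst) (max_le hab (min_le_left _ _))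
    refine h1.trans ?_
    rw [Real.mul_rpow (by positivity) h0]
    have h2 : C ≤ (C ^ (1 / α) + 1) ^ α := by
      calc C = (C ^ (1 / α)) ^ α := by
            rw [← Real.rpow_mul hC0, one_div_mul_cancel hα0.ne', Real.rpow_one]
        _ ≤ _ := Real.rpow_le_rpow (by positivity) (by linarith) hα0.le
    have h3 : (κ t - κ s) ^ α ≤ (t - s) ^ α :=
      Real.rpow_le_rpow (sub_nonneg.2 (hκ2 s t hst)) (hκ3 s t hst) hα0.le
    have h4 : 0 ≤ (κ t - κ s) ^ α := Real.rpow_nonneg (sub_nonneg.2 (hκ2 s t hst)) _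
    calc C * (κ t - κ s) ^ α ≤ (C ^ (1 / α) + 1) ^ α * (κ t - κ s) ^ α := by gcongr
      _ ≤ _ := by gcongr
  obtain ⟨y, h1, h2, M, hM0, hM⟩ := exists_davie_of_global (x := fun t => x (κ t))
    (c := C ^ (1 / α) + 1) hα hK hf hfl (by positivity) hκx hab y₀
  refine ⟨y, h1, h2, M, hM0, fun s t h3 h4 h5 => ?_⟩
  have := hM s t h3 h4 h5
  simp only [hκ1 s ⟨h3, h4.trans h5⟩, hκ1 t ⟨h3.trans h4, h5⟩] at this
  exact this

end

/-! ### Taylor and four-point inequalities -/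

section Taylor

variable {E H : Type*} [NormedAddCommGroup E] [NormedSpace ℝ E] [NormedAddCommGroup H]
  [NormedSpace ℝ H] {f : E → H} {K : ℝ}

theorem norm_taylor_le (hf : Differentiable ℝ f)
    (hK : ∀ p q, ‖fderiv ℝ f p - fderiv ℝ f q‖ ≤ K * ‖p - q‖) (hK0 : 0 ≤ K) (p q : E) :
    ‖f p - f q - fderiv ℝ f q (p - q)‖ ≤ K * ‖p - q‖ ^ 2 := by
  have := (convex_closedBall q ‖p - q‖).norm_image_sub_le_of_norm_fderiv_le' (𝕜 := ℝ) (f := f)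
    (φ := fderiv ℝ f q) (C := K * ‖p - q‖) (x := q) (y := p) (fun u _ => hf u) (fun u hu => ?_)
    (by simp) (by simp [dist_eq_norm])
  · refine this.trans (le_of_eq (by ring))
  · rw [mem_closedBall_iff_norm] at hu
    exact (hK u q).trans (by gcongr)

theorem norm_lineMap_le (Δ₀ Δ₁ : E) {l : ℝ} (h : l ∈ Icc (0 : ℝ) 1) :
    ‖Δ₀ + l • (Δ₁ - Δ₀)‖ ≤ max ‖Δ₀‖ ‖Δ₁‖ := by
  have e : Δ₀ + l • (Δ₁ - Δ₀) = (1 - l) • Δ₀ + l • Δ₁ := by module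
  rw [e]
  refine (norm_add_le _ _).trans ?_
  rw [norm_smul, norm_smul, Real.norm_of_nonneg h.1, Real.norm_of_nonneg (by linarith [h.2])]
  have h1 := mul_le_mul_of_nonneg_left (le_max_left ‖Δ₀‖ ‖Δ₁‖) (show 0 ≤ 1 - l by linarith [h.2])
  have h2 := mul_le_mul_of_nonneg_left (le_max_right ‖Δ₀‖ ‖Δ₁‖) h.1
  linarith

theorem hasDerivAt_line (q v : E) (l : ℝ) : HasDerivAt (fun l : ℝ => q + l • v) v l := by
  simpa using ((hasDerivAt_id l).smul_const v).const_add q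

/-- The four-point inequality. -/
theorem norm_four_point_le (hf : Differentiable ℝ f) (hb : ∀ p, ‖fderiv ℝ f p‖ ≤ K)
    (hK : ∀ p q, ‖fderiv ℝ f p - fderiv ℝ f q‖ ≤ K * ‖p - q‖) (hK0 : 0 ≤ K) (p q p' q' : E) :
    ‖(f p' - f q') - (f p - f q)‖ ≤
      K * ‖(p' - q') - (p - q)‖ + K * max ‖p - q‖ ‖p' - q'‖ * ‖q' - q‖ := by
  -- Both points move linearly at the same time. P - Q then runs along the segment from p - q to p'
  -- - q', which is why the larger of the two norms appears.
  set Q : ℝ → E := fun l => q + l • (q' - q) with hQ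
  set P : ℝ → E := fun l => p + l • (p' - p) with hP
  have := norm_image_sub_le_of_norm_deriv_le_segment_01' (f := fun l => f (P l) - f (Q l))
    (f' := fun l => fderiv ℝ f (P l) (p' - p) - fderiv ℝ f (Q l) (q' - q))
    (C := K * ‖(p' - q') - (p - q)‖ + K * max ‖p - q‖ ‖p' - q'‖ * ‖q' - q‖)
    (fun l _ => ?_) (fun l hl => ?_)
  · simpa [hP, hQ] using this
  · exact (((hf _).hasFDerivAt.comp_hasDerivAt l (hasDerivAt_line p _ l)).sub
      ((hf _).hasFDerivAt.comp_hasDerivAt l (hasDerivAt_line q _ l))).hasDerivWithinAt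
  · have e : fderiv ℝ f (P l) (p' - p) - fderiv ℝ f (Q l) (q' - q)
        = fderiv ℝ f (P l) ((p' - q') - (p - q))
          + (fderiv ℝ f (P l) - fderiv ℝ f (Q l)) (q' - q) := by
      simp only [map_sub, sub_apply]; abel
    have hPQ : ‖P l - Q l‖ ≤ max ‖p - q‖ ‖p' - q'‖ := by
      have : P l - Q l = (p - q) + l • ((p' - q') - (p - q)) := by simp only [hP, hQ]; module
      rw [this]
      exact norm_lineMap_le _ _ ⟨hl.1, hl.2.le⟩
    rw [e]
    refine (norm_add_le _ _).trans (add_le_add ?_ ?_)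
    · exact (ContinuousLinearMap.le_opNorm _ _).trans (by gcongr; exact hb _)
    · exact (ContinuousLinearMap.le_opNorm _ _).trans (by gcongr; exact (hK _ _).trans (by gcongr))

/-- The increments of the first order Taylor remainder. -/
theorem norm_taylor_sub_taylor_le (hf : ContDiff ℝ 2 f)
    (hK : ∀ p q, ‖fderiv ℝ f p - fderiv ℝ f q‖ ≤ K * ‖p - q‖)
    (hK2 : ∀ p q, ‖fderiv ℝ (fderiv ℝ f) p - fderiv ℝ (fderiv ℝ f) q‖ ≤ K * ‖p - q‖)
    (hK0 : 0 ≤ K) (p q p' q' : E) :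
    ‖(f p' - f q' - fderiv ℝ f q' (p' - q')) - (f p - f q - fderiv ℝ f q (p - q))‖ ≤
      K * max ‖p - q‖ ‖p' - q'‖ ^ 2 * ‖q' - q‖
        + K * max ‖p - q‖ ‖p' - q'‖ * ‖(p' - q') - (p - q)‖ := by
  set Q : ℝ → E := fun l => q + l • (q' - q) with hQ
  set P : ℝ → E := fun l => p + l • (p' - p) with hP
  set m := max ‖p - q‖ ‖p' - q'‖ with hm
  have hm0 : 0 ≤ m := (norm_nonneg _).trans (le_max_left _ _)
  have hd : Differentiable ℝ f := hf.differentiable (by norm_num)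
  have hd1 : Differentiable ℝ (fderiv ℝ f) :=
    (hf.fderiv_right (m := 1) (by norm_num)).differentiable (by norm_num)
  have := norm_image_sub_le_of_norm_deriv_le_segment_01'
    (f := fun l => f (P l) - f (Q l) - fderiv ℝ f (Q l) (P l - Q l))
    (f' := fun l => fderiv ℝ f (P l) (p' - p) - fderiv ℝ f (Q l) (q' - q)
      - (fderiv ℝ (fderiv ℝ f) (Q l) (q' - q) (P l - Q l)
        + fderiv ℝ f (Q l) ((p' - p) - (q' - q))))
    (C := K * m ^ 2 * ‖q' - q‖ + K * m * ‖(p' - q') - (p - q)‖)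
    (fun l _ => ?_) (fun l hl => ?_)
  · simpa [hP, hQ] using this
  · have hP' := hasDerivAt_line p (p' - p) l
    have hQ' := hasDerivAt_line q (q' - q) l
    have h1 := (hd1 _).hasFDerivAt.comp_hasDerivAt l hQ'
    exact ((((hd _).hasFDerivAt.comp_hasDerivAt l hP').sub
      ((hd _).hasFDerivAt.comp_hasDerivAt l hQ')).sub
        (h1.clm_apply (hP'.sub hQ'))).hasDerivWithinAt
  -- By symmetry of D²f the direction q' - q can be factored out, leaving the first order Taylor
  -- remainder of Df, which is quadratic in P - Q.
  · have hsymm : fderiv ℝ (fderiv ℝ f) (Q l) (q' - q) (P l - Q l)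
        = fderiv ℝ (fderiv ℝ f) (Q l) (P l - Q l) (q' - q) :=
      (hf.contDiffAt.isSymmSndFDerivAt (by simp)) _ _
    have e : fderiv ℝ f (P l) (p' - p) - fderiv ℝ f (Q l) (q' - q)
        - (fderiv ℝ (fderiv ℝ f) (Q l) (q' - q) (P l - Q l)
          + fderiv ℝ f (Q l) ((p' - p) - (q' - q)))
        = (fderiv ℝ f (P l) - fderiv ℝ f (Q l)
            - fderiv ℝ (fderiv ℝ f) (Q l) (P l - Q l)) (q' - q)
          + (fderiv ℝ f (P l) - fderiv ℝ f (Q l)) ((p' - q') - (p - q)) := by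
      rw [hsymm]
      simp only [map_sub, sub_apply]; abel
    have hPQ : ‖P l - Q l‖ ≤ m := by
      have : P l - Q l = (p - q) + l • ((p' - q') - (p - q)) := by simp only [hP, hQ]; module
      rw [this]
      exact norm_lineMap_le _ _ ⟨hl.1, hl.2.le⟩
    rw [e]
    refine (norm_add_le _ _).trans (add_le_add ?_ ?_)
    · refine (ContinuousLinearMap.le_opNorm _ _).trans ?_
      gcongr
      exact (norm_taylor_le hd1 hK2 hK0 _ _).trans (by gcongr)
    · exact (ContinuousLinearMap.le_opNorm _ _).trans (by gcongr; exact (hK _ _).trans (by gcongr))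

/-- `f` is of class `C³`, and `K` bounds `f`, `Df` and the Lipschitz constants of `Df`, `D²f`. -/
structure IsC3Bounded (K : ℝ) (f : E → H) : Prop where
  nonneg : 0 ≤ K
  contDiff : ContDiff ℝ 3 f
  norm_le : ∀ p, ‖f p‖ ≤ K
  norm_fderiv_le : ∀ p, ‖fderiv ℝ f p‖ ≤ K
  norm_fderiv_sub_le : ∀ p q, ‖fderiv ℝ f p - fderiv ℝ f q‖ ≤ K * ‖p - q‖
  norm_fderiv_fderiv_sub_le : ∀ p q,
    ‖fderiv ℝ (fderiv ℝ f) p - fderiv ℝ (fderiv ℝ f) q‖ ≤ K * ‖p - q‖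

theorem norm_sub_le_of_fderiv_bound (hf : Differentiable ℝ f) (hb : ∀ p, ‖fderiv ℝ f p‖ ≤ K)
    (p q : E) : ‖f p - f q‖ ≤ K * ‖p - q‖ :=
  convex_univ.norm_image_sub_le_of_norm_fderiv_le (𝕜 := ℝ) (fun u _ => hf u) (fun u _ => hb u)
    (mem_univ q) (mem_univ p)

theorem IsC3Bounded.differentiable (h : IsC3Bounded K f) : Differentiable ℝ f :=
  h.contDiff.differentiable (by norm_num)

theorem IsC3Bounded.norm_sub_le (h : IsC3Bounded K f) (p q : E) : ‖f p - f q‖ ≤ K * ‖p - q‖ :=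
  norm_sub_le_of_fderiv_bound h.differentiable h.norm_fderiv_le p q

theorem norm_sub_le_of_iteratedFDeriv_one (hf : Differentiable ℝ f)
    (hb : ∀ p, ‖iteratedFDeriv ℝ 1 f p‖ ≤ K) (p q : E) : ‖f p - f q‖ ≤ K * ‖p - q‖ :=
  norm_sub_le_of_fderiv_bound hf (fun p => norm_iteratedFDeriv_one (𝕜 := ℝ) (f := f) ▸ hb p) p q

theorem isC3Bounded_of_iteratedFDeriv (hc : ContDiff ℝ 3 f)
    (h : ∀ k ≤ 3, ∀ p, ‖iteratedFDeriv ℝ k f p‖ ≤ K) : IsC3Bounded K f := by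
  have h0 : ∀ p, ‖f p‖ ≤ K := fun p => by simpa using h 0 (by norm_num) p
  have h1 : ∀ p, ‖fderiv ℝ f p‖ ≤ K := fun p => by simpa using h 1 (by norm_num) p
  have c1 : ContDiff ℝ 2 (fderiv ℝ f) := hc.fderiv_right (by norm_num)
  have c2 : ContDiff ℝ 1 (fderiv ℝ (fderiv ℝ f)) := c1.fderiv_right (by norm_num)
  exact ⟨(norm_nonneg _).trans (h0 0), hc, h0, h1,
    norm_sub_le_of_iteratedFDeriv_one (c1.differentiable (by norm_num)) fun p => by
      rw [norm_iteratedFDeriv_fderiv]; exact h 2 (by norm_num) p,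
    norm_sub_le_of_iteratedFDeriv_one (c2.differentiable (by norm_num)) fun p => by
      rw [norm_iteratedFDeriv_fderiv, norm_iteratedFDeriv_fderiv]; exact h 3 (by norm_num) p⟩

end Taylor

/-! ### Stability of Davie and Hölder bounds under algebraic operations -/

section Closure

variable {F G : Type*} [NormedAddCommGroup F] [NormedSpace ℝ F] [NormedAddCommGroup G]
  [NormedSpace ℝ G] {x : ℝ → F} {α a b : ℝ}

theorem IsDavie.sum {ι : Type*} (s : Finset ι) {z : ι → ℝ → G} {g : ι → ℝ → F →L[ℝ] G}
    (h : ∀ i, IsDavie α a b x (g i) (z i)) :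
    IsDavie α a b x (fun t => ∑ i ∈ s, g i t) (fun t => ∑ i ∈ s, z i t) := by
  choose M hM0 hM using h
  refine ⟨∑ i ∈ s, M i, Finset.sum_nonneg fun i _ => hM0 i, fun u t h1 h2 h3 => ?_⟩
  rw [Finset.sum_mul]
  have e : ∑ i ∈ s, z i t - ∑ i ∈ s, z i u - (∑ i ∈ s, g i u) (x t - x u)
      = ∑ i ∈ s, (z i t - z i u - g i u (x t - x u)) := by
    simp [Finset.sum_sub_distrib]
  rw [e]
  exact norm_sum_le_of_le _ fun i _ => hM i u t h1 h2 h3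

theorem HolderBound.sum {ι : Type*} (s : Finset ι) {z : ι → ℝ → G}
    (h : ∀ i, HolderBound α a b (z i)) : HolderBound α a b (fun t => ∑ i ∈ s, z i t) := by
  choose M hM0 hM using h
  refine ⟨∑ i ∈ s, M i, Finset.sum_nonneg fun i _ => hM0 i, fun u t h1 h2 h3 => ?_⟩
  rw [Finset.sum_mul, ← Finset.sum_sub_distrib]
  exact norm_sum_le_of_le _ fun i _ => hM i u t h1 h2 h3

theorem HolderBound.sub {z z' : ℝ → G} (h : HolderBound α a b z) (h' : HolderBound α a b z') :
    HolderBound α a b (fun t => z t - z' t) := by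
  obtain ⟨C, hC0, hC⟩ := h
  obtain ⟨C', hC0', hC'⟩ := h'
  refine ⟨C + C', by positivity, fun s t h1 h2 h3 => ?_⟩
  rw [show z t - z' t - (z s - z' s) = (z t - z s) - (z' t - z' s) by abel, add_mul]
  exact (norm_sub_le _ _).trans (add_le_add (hC s t h1 h2 h3) (hC' s t h1 h2 h3))

theorem HolderBound.comp_lipschitz {H : Type*} [NormedAddCommGroup H] {z : ℝ → G}
    (h : HolderBound α a b z) {f : G → H} {K : ℝ} (hK : 0 ≤ K)
    (hf : ∀ p q, ‖f p - f q‖ ≤ K * ‖p - q‖) : HolderBound α a b (fun t => f (z t)) := by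
  obtain ⟨C, hC0, hC⟩ := h
  refine ⟨K * C, by positivity, fun s t h1 h2 h3 => (hf _ _).trans ?_⟩
  rw [mul_assoc]
  exact mul_le_mul_of_nonneg_left (hC s t h1 h2 h3) hK

theorem HolderBound.map {H : Type*} [NormedAddCommGroup H] [NormedSpace ℝ H] {z : ℝ → G}
    (h : HolderBound α a b z) (T : G →L[ℝ] H) : HolderBound α a b (fun t => T (z t)) :=
  h.comp_lipschitz (norm_nonneg T) fun p q => by
    rw [← map_sub]; exact T.le_opNorm _

theorem HolderBound.bilinear {H H' : Type*} [NormedAddCommGroup H] [NormedSpace ℝ H]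
    [NormedAddCommGroup H'] [NormedSpace ℝ H'] {z : ℝ → G} {w : ℝ → H} (hα : 0 < α)
    (hz : HolderBound α a b z) (hw : HolderBound α a b w) (T : G →L[ℝ] H →L[ℝ] H') :
    HolderBound α a b (fun t => T (z t) (w t)) := by
  obtain ⟨Z, hZ0, hZ⟩ := hz.bounded hα
  obtain ⟨W, hW0, hW⟩ := hw.bounded hα
  obtain ⟨C, hC0, hC⟩ := hz
  obtain ⟨C', hC0', hC'⟩ := hw
  refine ⟨‖T‖ * C * W + ‖T‖ * Z * C', by positivity, fun s t h1 h2 h3 => ?_⟩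
  have e : T (z t) (w t) - T (z s) (w s) = T (z t - z s) (w t) + T (z s) (w t - w s) := by
    simp only [map_sub, sub_apply]; abel
  have hp : 0 ≤ (t - s) ^ α := Real.rpow_nonneg (by linarith) _
  rw [e, add_mul]
  refine (norm_add_le _ _).trans (add_le_add ?_ ?_)
  · calc _ ≤ ‖T‖ * ‖z t - z s‖ * ‖w t‖ := T.le_opNorm₂ _ _
      _ ≤ ‖T‖ * (C * (t - s) ^ α) * W := by
        gcongr
        · exact hC s t h1 h2 h3
        · exact hW t ⟨h1.trans h2, h3⟩
      _ = _ := by ring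
  · calc _ ≤ ‖T‖ * ‖z s‖ * ‖w t - w s‖ := T.le_opNorm₂ _ _
      _ ≤ ‖T‖ * Z * (C' * (t - s) ^ α) := by
        gcongr
        · exact hZ s ⟨h1, h2.trans h3⟩
        · exact hC' s t h1 h2 h3
      _ = _ := by ring

end Closure

/-! ### Global estimate for linear equations -/

section

variable {F G : Type*} [NormedAddCommGroup F] [NormedSpace ℝ F] [NormedAddCommGroup G]
  [NormedSpace ℝ G] {x : ℝ → F} {α a b : ℝ} {ω : ℝ → ℝ → ℝ}

theorem localConst_mono {A A' : ℝ} (hα : 1 / 2 < α) (hA : 0 ≤ A) (h : A ≤ A') :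
    localConst α A ≤ localConst α A' := by
  have := sewingConst_pos (show 1 < 2 * α by linarith)
  simp only [localConst]
  gcongr

/-- The global a priori estimate for `dz = g dx`, where `g` depends on `z` in a linear way. -/
theorem IsDriver.linear_estimate (hd : IsDriver α a b x ω) (hα : 1 / 2 < α) {z : ℝ → G}
    {g : ℝ → F →L[ℝ] G} (hz : IsDavie α a b x g z) (hzh : HolderBound α a b z) {A B ε : ℝ}
    (hA : 0 ≤ A) (hB : 0 ≤ B)
    (hε : ∀ w, 0 ≤ w → w ≤ ε → 2 * localConst α A * w ^ α ≤ 1)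
    (hg : ∀ s ∈ Icc a b, ‖g s‖ ≤ A * ‖z s‖ + B)
    (hgd : ∀ s t, a ≤ s → s ≤ t → t ≤ b → ω s t ≤ ε →
      ‖g t - g s‖ ≤ A * ‖z t - z s‖ + (A * max ‖z s‖ ‖z t‖ + B) * ω s t ^ α) {k : ℕ}
    (hk : ω a b ≤ (k + 1) * ε) :
    (∀ t ∈ Icc a b, ‖z t‖ ≤ 2 ^ (k + 1) * (‖z a‖ + B)) ∧
    (∀ s t, a ≤ s → s ≤ t → t ≤ b → ω s t ≤ ε → ‖z t - z s - g s (x t - x s)‖ ≤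
      localConst α A * (‖z s‖ + B) * ω s t ^ (2 * α)) ∧
    (∀ s t, a ≤ s → s ≤ t → t ≤ b → ω s t ≤ ε → ‖z t - z s‖ ≤
      localConst α A * (‖z s‖ + B) * ω s t ^ α) := by
  have hα0 : 0 < α := by linarith
  have key := fun (s t : ℝ) (h1 : a ≤ s) (h2 : s ≤ t) (h3 : t ≤ b) (h4 : ω s t ≤ ε) =>
    hd.local_estimate hα hz ((hzh.bounded hα0).imp fun _ h => h.2) hA hB h1 h2 h3
      (hε _ (hd.control.nonneg s t h1 h2 h3) h4)
      (fun u hu hu' => hg u ⟨h1.trans hu, hu'.trans h3⟩)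
      (fun u v hu huv hv => hgd u v (h1.trans hu) huv (hv.trans h3)
        ((hd.control.mono h1 hu huv hv h3).trans h4))
  refine ⟨fun t ht => ?_, fun s t h1 h2 h3 h4 => (key s t h1 h2 h3 h4).2.1 s t le_rfl h2 le_rfl,
    fun s t h1 h2 h3 h4 => (key s t h1 h2 h3 h4).2.2 s t le_rfl h2 le_rfl⟩
  -- Adding B makes the local bound ‖z_t‖ ≤ 2‖z_s‖ + B purely multiplicative.
  have := gronwall_control (f := fun t => ‖z t‖ + B) hd.control
    ((hzh.continuousOn hα0).norm.add continuousOn_const) (fun t _ => by positivity)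
    (fun s t h1 h2 h3 h4 => by
      have := (key s t h1 h2 h3 h4).1 t h2 le_rfl
      linarith) k a t le_rfl ht.1 ht.2
      ((hd.control.mono le_rfl le_rfl ht.1 ht.2 le_rfl).trans hk)
  linarith

/-- A solution of `dy = σ(y) dx` in the sense of Davie. -/
structure IsDavieSolution (α a b : ℝ) (x : ℝ → F) (σ : G → F →L[ℝ] G) (y : ℝ → G) : Prop where
  holder : HolderBound α a b y
  davie : IsDavie α a b x (fun t => σ (y t)) y

/-- The Lipschitz constant for the equations linearized along solutions. -/
noncomputable def flowConst (α K : ℝ) : ℝ := K * (1 + localConst α K * K)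

theorem le_flowConst {K : ℝ} (hα : 1 / 2 < α) (hK : 0 ≤ K) : K ≤ flowConst α K := by
  have := localConst_ge_one hα hK
  have h2 : 0 ≤ K * (localConst α K * K) := by positivity
  rw [flowConst]; linarith

end

/-! ### Dependence on the initial datum: Lipschitz bound, uniqueness, quadratic remainder -/

section Flow

variable {E F : Type*} [NormedAddCommGroup E] [NormedSpace ℝ E]
  [NormedAddCommGroup F] [NormedSpace ℝ F] {x : ℝ → F} {α a b K ε : ℝ} {ω : ℝ → ℝ → ℝ}
  {σ : E → F →L[ℝ] E} {y y' : ℝ → E}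

/-- The local estimate is applied to y - y_s, which vanishes at s and has coefficient bounded by K.
Hence the bound involves neither the initial datum nor the Hölder constant of y. -/
theorem IsDavieSolution.norm_sub_le (hy : IsDavieSolution α a b x σ y) (hα : 1 / 2 < α)
    (hσ : IsC3Bounded K σ) (hd : IsDriver α a b x ω)
    (hε : ∀ w, 0 ≤ w → w ≤ ε → 2 * localConst α (flowConst α K) * w ^ α ≤ 1) {s t : ℝ}
    (h1 : a ≤ s) (h2 : s ≤ t) (h3 : t ≤ b) (h4 : ω s t ≤ ε) :
    ‖y t - y s‖ ≤ localConst α K * K * ω s t ^ α := by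
  have hK := hσ.nonneg
  have hw := hd.control.nonneg s t h1 h2 h3
  have hdiff : ∀ u v, y v - y s - (y u - y s) = y v - y u := fun u v => by abel
  obtain ⟨Y, -, hY⟩ := hy.holder.bounded (by linarith)
  have := (hd.local_estimate hα (hy.davie.sub_const (y s)) ⟨Y + ‖y s‖, fun t ht =>
      (_root_.norm_sub_le _ _).trans (by gcongr; exact hY t ht)⟩ hK hK h1 h2 h3 ?_
      (fun u _ _ => (hσ.norm_le _).trans (le_add_of_nonneg_left (by positivity)))
      (fun u v hu huv hv => ?_)).2.2 s t le_rfl h2 le_rfl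
  · simpa using this
  · refine le_trans ?_ (hε _ hw h4)
    have := localConst_mono hα hK (le_flowConst hα hK)
    gcongr
  · simp only [hdiff]
    have : 0 ≤ ω u v ^ α :=
      Real.rpow_nonneg (hd.control.nonneg u v (h1.trans hu) huv (hv.trans h3)) _
    exact (hσ.norm_sub_le _ _).trans (le_add_of_nonneg_right (by positivity))

/-- Lipschitz estimates for the difference of two solutions. -/
theorem IsDavieSolution.difference_estimate (hy : IsDavieSolution α a b x σ y)
    (hy' : IsDavieSolution α a b x σ y') (hα : 1 / 2 < α)
    (hσ : IsC3Bounded K σ) (hd : IsDriver α a b x ω)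
    (hε : ∀ w, 0 ≤ w → w ≤ ε → 2 * localConst α (flowConst α K) * w ^ α ≤ 1) {k : ℕ}
    (hk : ω a b ≤ (k + 1) * ε) :
    (∀ t ∈ Icc a b, ‖y' t - y t‖ ≤ 2 ^ (k + 1) * ‖y' a - y a‖) ∧
    (∀ s t, a ≤ s → s ≤ t → t ≤ b → ω s t ≤ ε →
      ‖(y' t - y t) - (y' s - y s) - (σ (y' s) - σ (y s)) (x t - x s)‖ ≤
        localConst α (flowConst α K) * ‖y' s - y s‖ * ω s t ^ (2 * α)) ∧
    (∀ s t, a ≤ s → s ≤ t → t ≤ b → ω s t ≤ ε → ‖(y' t - y t) - (y' s - y s)‖ ≤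
      localConst α (flowConst α K) * ‖y' s - y s‖ * ω s t ^ α) := by
  have hK := hσ.nonneg
  have hKA := le_flowConst hα hK
  have := hd.linear_estimate hα (hy'.davie.sub hy.davie) (hy'.holder.sub hy.holder)
    (hK.trans hKA) le_rfl hε (fun s _ => ?_) (fun s t h1 h2 h3 h4 => ?_) hk
  · simpa only [add_zero] using this
  · rw [add_zero]
    exact (hσ.norm_sub_le _ _).trans (by gcongr)
  · rw [add_zero]
    have hw : 0 ≤ ω s t ^ α := Real.rpow_nonneg (hd.control.nonneg s t h1 h2 h3) _
    -- The four-point inequality leaves a term with ‖y_t - y_s‖, itself at most `localConst α K * K`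
    -- times ω^α. This is the origin of the second summand in `flowConst`.
    refine (norm_four_point_le hσ.differentiable hσ.norm_fderiv_le hσ.norm_fderiv_sub_le hK _ _ _
      _).trans (add_le_add (by gcongr) ?_)
    have h5 := hy.norm_sub_le hα hσ hd hε h1 h2 h3 h4
    have hm : 0 ≤ max ‖y' s - y s‖ ‖y' t - y t‖ := (norm_nonneg _).trans (le_max_left _ _)
    calc K * max ‖y' s - y s‖ ‖y' t - y t‖ * ‖y t - y s‖
        ≤ K * max ‖y' s - y s‖ ‖y' t - y t‖ * (localConst α K * K * ω s t ^ α) := by gcongr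
      _ = (K * (localConst α K * K)) * max ‖y' s - y s‖ ‖y' t - y t‖ * ω s t ^ α := by ring
      _ ≤ _ := by
        gcongr
        rw [flowConst]; linarith

theorem exists_mul_ge {ε : ℝ} (hε : 0 < ε) (w : ℝ) : ∃ k : ℕ, w ≤ (k + 1) * ε := by
  obtain ⟨k, hk⟩ := exists_nat_ge (w / ε)
  rw [div_le_iff₀ hε] at hk
  exact ⟨k, by linarith⟩

theorem exists_small_flowConst (hα : 1 / 2 < α) (hK : 0 ≤ K) :
    ∃ ε, 0 < ε ∧ ∀ w, 0 ≤ w → w ≤ ε → 2 * localConst α (flowConst α K) * w ^ α ≤ 1 := by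
  have := localConst_ge_one hα (hK.trans (le_flowConst hα hK))
  exact exists_small_rpow (by linarith) (by linarith)

theorem IsDavieSolution.eqOn (hy : IsDavieSolution α a b x σ y)
    (hy' : IsDavieSolution α a b x σ y') (hα : 1 / 2 < α) (hσ : IsC3Bounded K σ)
    (hd : IsDriver α a b x ω) (h : y' a = y a) : EqOn y' y (Icc a b) := by
  obtain ⟨ε, hε0, hε⟩ := exists_small_flowConst hα hσ.nonneg
  obtain ⟨k, hk⟩ := exists_mul_ge hε0 (ω a b)
  intro t ht
  have := (hy.difference_estimate hy' hα hσ hd hε hk).1 t ht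
  rw [h, sub_self, norm_zero, mul_zero] at this
  exact sub_eq_zero.1 (norm_le_zero_iff.1 this)

/-- The coefficient `w ↦ (v ↦ Dσ(y) (ξ v) w)` of the linearized equation for matrices. -/
noncomputable def linearizedCoeff (σ : E → F →L[ℝ] E) (p : E) (ξ : E →L[ℝ] E) :
    F →L[ℝ] E →L[ℝ] E :=
  ((fderiv ℝ σ p).comp ξ).flip

theorem norm_linearizedCoeff_le (p : E) (ξ : E →L[ℝ] E) :
    ‖linearizedCoeff σ p ξ‖ ≤ ‖fderiv ℝ σ p‖ * ‖ξ‖ := by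
  rw [linearizedCoeff, ContinuousLinearMap.opNorm_flip]
  exact ContinuousLinearMap.opNorm_comp_le _ _

theorem linearizedCoeff_sub (p : E) (ξ ξ' : E →L[ℝ] E) :
    linearizedCoeff σ p ξ - linearizedCoeff σ p ξ' = linearizedCoeff σ p (ξ - ξ') := by
  ext w v; simp [linearizedCoeff]

theorem norm_linearizedCoeff_sub_le (p p' : E) (ξ ξ' : E →L[ℝ] E) :
    ‖linearizedCoeff σ p' ξ' - linearizedCoeff σ p ξ‖ ≤
      ‖fderiv ℝ σ p'‖ * ‖ξ' - ξ‖ + ‖fderiv ℝ σ p' - fderiv ℝ σ p‖ * ‖ξ‖ := by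
  have e : linearizedCoeff σ p' ξ' - linearizedCoeff σ p ξ
      = ((fderiv ℝ σ p').comp (ξ' - ξ) + (fderiv ℝ σ p' - fderiv ℝ σ p).comp ξ).flip := by
    ext w v; simp [linearizedCoeff]
  rw [e, ContinuousLinearMap.opNorm_flip]
  have h1 := norm_add_le ((fderiv ℝ σ p').comp (ξ' - ξ)) ((fderiv ℝ σ p' - fderiv ℝ σ p).comp ξ)
  have h2 := (fderiv ℝ σ p').opNorm_comp_le (ξ' - ξ)
  have h3 := (fderiv ℝ σ p' - fderiv ℝ σ p).opNorm_comp_le ξ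
  linarith

/-- Uniqueness for the linearized equation. -/
theorem IsDavieSolution.linearized_eqOn (hy : IsDavieSolution α a b x σ y) (hα : 1 / 2 < α)
    (hσ : IsC3Bounded K σ) (hd : IsDriver α a b x ω) {ξ ξ' : ℝ → E →L[ℝ] E}
    (hξ : HolderBound α a b ξ) (hξ' : HolderBound α a b ξ')
    (hD : IsDavie α a b x (fun t => linearizedCoeff σ (y t) (ξ t)) ξ)
    (hD' : IsDavie α a b x (fun t => linearizedCoeff σ (y t) (ξ' t)) ξ') (h : ξ' a = ξ a) :
    EqOn ξ' ξ (Icc a b) := by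
  have hK := hσ.nonneg
  have hKA := le_flowConst hα hK
  have hL := localConst_ge_one hα hK
  obtain ⟨ε, hε0, hε⟩ := exists_small_flowConst hα hσ.nonneg
  obtain ⟨k, hk⟩ := exists_mul_ge hε0 (ω a b)
  have hDD := hD'.sub hD
  simp only [linearizedCoeff_sub] at hDD
  have := hd.linear_estimate hα hDD (hξ'.sub hξ) (hK.trans hKA) le_rfl hε (fun s _ => ?_)
    (fun s t h1 h2 h3 h4 => ?_) hk
  · intro t ht
    have := this.1 t ht
    rw [h, sub_self, norm_zero, add_zero, mul_zero] at this
    exact sub_eq_zero.1 (norm_le_zero_iff.1 this)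
  · rw [add_zero]
    refine (norm_linearizedCoeff_le _ _).trans ?_
    gcongr
    exact (hσ.norm_fderiv_le _).trans hKA
  · rw [add_zero]
    have hw : 0 ≤ ω s t ^ α := Real.rpow_nonneg (hd.control.nonneg s t h1 h2 h3) _
    refine (norm_linearizedCoeff_sub_le _ _ _ _).trans (add_le_add ?_ ?_)
    · gcongr
      exact (hσ.norm_fderiv_le _).trans hKA
    · have h5 := hy.norm_sub_le hα hσ hd hε h1 h2 h3 h4
      calc _ ≤ (K * (localConst α K * K * ω s t ^ α)) * max ‖ξ' s - ξ s‖ ‖ξ' t - ξ t‖ := by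
            gcongr
            · exact (hσ.norm_fderiv_sub_le _ _).trans (by gcongr)
            · exact le_max_left _ _
        _ = (K * (localConst α K * K)) * max ‖ξ' s - ξ s‖ ‖ξ' t - ξ t‖ * ω s t ^ α := by ring
        _ ≤ _ := by
          gcongr
          rw [flowConst]; linarith

/-- The constant in the quadratic remainder estimate, for controls with `ω a b ≤ (k + 1) ε`. -/
noncomputable def remainderConst (α K : ℝ) (k : ℕ) : ℝ :=
  2 ^ (k + 1) * (K * (2 ^ (k + 1)) ^ 2 * (1 + localConst α K * K + localConst α (flowConst α K)))

/-- The quadratic remainder estimate for the flow. -/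
theorem IsDavieSolution.remainder_estimate (hy : IsDavieSolution α a b x σ y)
    (hy' : IsDavieSolution α a b x σ y') (hα : 1 / 2 < α)
    (hσ : IsC3Bounded K σ) (hd : IsDriver α a b x ω)
    (hε : ∀ w, 0 ≤ w → w ≤ ε → 2 * localConst α (flowConst α K) * w ^ α ≤ 1) {k : ℕ}
    (hk : ω a b ≤ (k + 1) * ε) {ξ : ℝ → E →L[ℝ] E} (hξ : HolderBound α a b ξ)
    (hD : IsDavie α a b x (fun t => linearizedCoeff σ (y t) (ξ t)) ξ)
    (h0 : ξ a = ContinuousLinearMap.id ℝ E) {t : ℝ} (ht : t ∈ Icc a b) :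
    ‖y' t - y t - ξ t (y' a - y a)‖ ≤ remainderConst α K k * ‖y' a - y a‖ ^ 2 := by
  have hK := hσ.nonneg
  have hKA := le_flowConst hα hK
  have hL := localConst_ge_one hα hK
  have hL' := localConst_ge_one hα (hK.trans hKA)
  set h := y' a - y a with hh
  obtain ⟨d1, -, d3⟩ := hy.difference_estimate hy' hα hσ hd hε hk
  set Q : ℝ := 2 ^ (k + 1) with hQ
  have hQ0 : 0 < Q := by positivity
  set r : ℝ → E := fun t => y' t - y t - ξ t h with hr
  set e : ℝ → F →L[ℝ] E := fun t => σ (y' t) - σ (y t) - fderiv ℝ σ (y t) (y' t - y t) with he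
  -- Subtracting the linearized equation in the direction h shows that r solves dr = (Dσ(y) r + e)
  -- dx, with the Taylor remainder e of σ as forcing.
  have hrD : IsDavie α a b x (fun t => fderiv ℝ σ (y t) (r t) + e t) r := by
    have h1 := (hy'.davie.sub hy.davie).sub (hD.map (ContinuousLinearMap.apply ℝ E h))
    have h2 : (fun t => σ (y' t) - σ (y t)
        - (ContinuousLinearMap.apply ℝ E h).comp (linearizedCoeff σ (y t) (ξ t)))
        = fun t => fderiv ℝ σ (y t) (r t) + e t := by
      funext t; ext w
      simp [linearizedCoeff, hr, he]
    rw [h2] at h1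
    exact h1
  have hrH : HolderBound α a b r :=
    (hy'.holder.sub hy.holder).sub (hξ.map (ContinuousLinearMap.apply ℝ E h))
  -- The three summands bound, in this order, the size of e, its change due to the motion of y, and
  -- its change due to the motion of y' - y.
  set B : ℝ := K * Q ^ 2 * (1 + localConst α K * K + localConst α (flowConst α K)) * ‖h‖ ^ 2 with hB
  have hB0 : 0 ≤ B := by positivity
  have hBe : ∀ s ∈ Icc a b, ‖e s‖ ≤ B := by
    intro s hs
    calc ‖e s‖ ≤ K * ‖y' s - y s‖ ^ 2 :=
          norm_taylor_le hσ.differentiable hσ.norm_fderiv_sub_le hK _ _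
      _ ≤ K * (Q * ‖h‖) ^ 2 := by gcongr; exact d1 s hs
      _ = K * Q ^ 2 * 1 * ‖h‖ ^ 2 := by ring
      _ ≤ B := by
        rw [hB]; gcongr
        have : 0 ≤ localConst α K * K := by positivity
        linarith
  have hBd : ∀ s t, a ≤ s → s ≤ t → t ≤ b → ω s t ≤ ε → ‖e t - e s‖ ≤ B * ω s t ^ α := by
    intro s t h1 h2 h3 h4
    have hw : 0 ≤ ω s t ^ α := Real.rpow_nonneg (hd.control.nonneg s t h1 h2 h3) _
    have e1 : max ‖y' s - y s‖ ‖y' t - y t‖ ≤ Q * ‖h‖ :=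
      max_le (d1 s ⟨h1, h2.trans h3⟩) (d1 t ⟨h1.trans h2, h3⟩)
    have e0 : 0 ≤ max ‖y' s - y s‖ ‖y' t - y t‖ := (norm_nonneg _).trans (le_max_left _ _)
    have e2 := hy.norm_sub_le hα hσ hd hε h1 h2 h3 h4
    have e3 : ‖(y' t - y t) - (y' s - y s)‖
        ≤ localConst α (flowConst α K) * (Q * ‖h‖) * ω s t ^ α :=
      (d3 s t h1 h2 h3 h4).trans (by gcongr; exact d1 s ⟨h1, h2.trans h3⟩)
    have e4 := norm_taylor_sub_taylor_le (hσ.contDiff.of_le (by norm_num)) hσ.norm_fderiv_sub_le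
      hσ.norm_fderiv_fderiv_sub_le hK (y' s) (y s) (y' t) (y t)
    calc ‖e t - e s‖ ≤ _ := e4
      _ ≤ K * (Q * ‖h‖) ^ 2 * (localConst α K * K * ω s t ^ α)
          + K * (Q * ‖h‖) * (localConst α (flowConst α K) * (Q * ‖h‖) * ω s t ^ α) := by
          gcongr
      _ = K * Q ^ 2 * (0 + localConst α K * K + localConst α (flowConst α K)) * ‖h‖ ^ 2
          * ω s t ^ α := by ring
      _ ≤ B * ω s t ^ α := by
        rw [hB]; gcongr; norm_num
  have hmain := (hd.linear_estimate hα hrD hrH (hK.trans hKA) hB0 hε (fun s hs => ?_)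
    (fun s t h1 h2 h3 h4 => ?_) hk).1 t ht
  · have hra : r a = 0 := by simp [hr, h0, hh]
    rw [hra, norm_zero, zero_add] at hmain
    refine hmain.trans (le_of_eq ?_)
    rw [remainderConst, hB]; ring
  · refine (norm_add_le _ _).trans (add_le_add ?_ (hBe s hs))
    refine (ContinuousLinearMap.le_opNorm _ _).trans ?_
    gcongr
    exact (hσ.norm_fderiv_le _).trans hKA
  · have hw : 0 ≤ ω s t ^ α := Real.rpow_nonneg (hd.control.nonneg s t h1 h2 h3) _
    have e1 : fderiv ℝ σ (y t) (r t) + e t - (fderiv ℝ σ (y s) (r s) + e s)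
        = fderiv ℝ σ (y t) (r t - r s) + (fderiv ℝ σ (y t) - fderiv ℝ σ (y s)) (r s)
          + (e t - e s) := by
      simp only [map_sub, sub_apply]; abel
    have h5 := hy.norm_sub_le hα hσ hd hε h1 h2 h3 h4
    have e2 : ‖fderiv ℝ σ (y t) (r t - r s)‖ ≤ flowConst α K * ‖r t - r s‖ := by
      refine (ContinuousLinearMap.le_opNorm _ _).trans ?_
      gcongr
      exact (hσ.norm_fderiv_le _).trans hKA
    have e3 : ‖(fderiv ℝ σ (y t) - fderiv ℝ σ (y s)) (r s)‖
        ≤ flowConst α K * max ‖r s‖ ‖r t‖ * ω s t ^ α := by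
      calc _ ≤ ‖fderiv ℝ σ (y t) - fderiv ℝ σ (y s)‖ * ‖r s‖ := ContinuousLinearMap.le_opNorm _ _
        _ ≤ (K * (localConst α K * K * ω s t ^ α)) * max ‖r s‖ ‖r t‖ := by
            gcongr
            · exact (hσ.norm_fderiv_sub_le _ _).trans (by gcongr)
            · exact le_max_left _ _
        _ = (K * (localConst α K * K)) * max ‖r s‖ ‖r t‖ * ω s t ^ α := by ring
        _ ≤ _ := by
          gcongr
          rw [flowConst]; linarith
    rw [e1, add_mul]
    have e4 := hBd s t h1 h2 h3 h4
    have e5 := norm_add₃_le (a := fderiv ℝ σ (y t) (r t - r s))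
      (b := (fderiv ℝ σ (y t) - fderiv ℝ σ (y s)) (r s)) (c := e t - e s)
    linarith

end Flow

/-! ### From Davie's formulation to Young solutions -/

section

variable {F G : Type*} [NormedAddCommGroup F] [NormedSpace ℝ F] [NormedAddCommGroup G]
  [NormedSpace ℝ G] {x : ℝ → F} {α a b : ℝ}

theorem HolderBound.congr {z z' : ℝ → G} (h : HolderBound α a b z) (hz : EqOn z z' (Icc a b)) :
    HolderBound α a b z' := by
  obtain ⟨C, hC0, hC⟩ := h
  refine ⟨C, hC0, fun s t h1 h2 h3 => ?_⟩
  rw [← hz ⟨h1, h2.trans h3⟩, ← hz ⟨h1.trans h2, h3⟩]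
  exact hC s t h1 h2 h3

theorem IsDavie.congr {z z' : ℝ → G} {g g' : ℝ → F →L[ℝ] G} (h : IsDavie α a b x g z)
    (hg : EqOn g g' (Icc a b)) (hz : EqOn z z' (Icc a b)) : IsDavie α a b x g' z' := by
  obtain ⟨M, hM0, hM⟩ := h
  refine ⟨M, hM0, fun s t h1 h2 h3 => ?_⟩
  rw [← hz ⟨h1, h2.trans h3⟩, ← hz ⟨h1.trans h2, h3⟩, ← hg ⟨h1, h2.trans h3⟩]
  exact hM s t h1 h2 h3

theorem IsDavie.isYoungSolution {V : ℝ → G → F →L[ℝ] G} {u₀ : G} {u : ℝ → G} (hα : 1 / 2 < α)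
    (hD : IsDavie α a b x (fun t => V t (u t)) u) (hH : HolderBound α a b u) (h0 : u a = u₀) :
    IsYoungSolution α a b x V u₀ u where
  holder := (isHolderPath_iff (by linarith)).2 hH
  initial := h0
  integral_eq t ht := h0 ▸ hD.hasYoungIntegral hα ht

end

/-! ### The linearized equation and the derivative of the flow -/

section Flow

variable {E F : Type*} [NormedAddCommGroup E] [NormedSpace ℝ E] [FiniteDimensional ℝ E]
  [NormedAddCommGroup F] [NormedSpace ℝ F] {x : ℝ → F} {α a b K : ℝ} {ω : ℝ → ℝ → ℝ}
  {σ : E → F →L[ℝ] E} {φ : E → ℝ → E}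

/-- Solutions of the linearized equation for vectors, as limits of difference quotients. -/
theorem exists_directional (hα : 1 / 2 < α) (hab : a ≤ b) (hσ : IsC3Bounded K σ)
    (hd : IsDriver α a b x ω) (hφ0 : ∀ y₀, φ y₀ a = y₀)
    (hφ : ∀ y₀, IsDavieSolution α a b x σ (φ y₀)) (y₀ v : E) :
    ∃ η : ℝ → E, η a = v ∧ HolderBound α a b η ∧
      IsDavie α a b x (fun t => fderiv ℝ σ (φ y₀ t) (η t)) η := by
  have hα0 : 0 < α := by linarith
  have hK := hσ.nonneg
  obtain ⟨ε, hε0, hε⟩ := exists_small_flowConst hα hK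
  obtain ⟨k, hk⟩ := exists_mul_ge hε0 (ω a b)
  obtain ⟨C, hC0, hC⟩ := hd.le_mul_sub
  set L := localConst α (flowConst α K) with hL
  have hL1 : 1 ≤ L := localConst_ge_one hα (hK.trans (le_flowConst hα hK))
  set Q : ℝ := 2 ^ (k + 1) with hQ
  have hQ0 : 0 < Q := by positivity
  set δ : ℕ → ℝ := fun n => 1 / ((n : ℝ) + 1) with hδ
  have hδ0 : ∀ n, 0 < δ n := fun n => by positivity
  set Δ : ℕ → ℝ → E := fun n t => φ (y₀ + δ n • v) t - φ y₀ t with hΔ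
  have hΔa : ∀ n, Δ n a = δ n • v := fun n => by simp [hΔ, hφ0]
  have est := fun n => (hφ y₀).difference_estimate (hφ (y₀ + δ n • v)) hα hσ hd hε hk
  have hΔa' : ∀ n, ‖Δ n a‖ = δ n * ‖v‖ := fun n => by
    rw [hΔa, norm_smul, Real.norm_of_nonneg (hδ0 n).le]
  have hΔb : ∀ n, ∀ t ∈ Icc a b, ‖Δ n t‖ ≤ δ n * (Q * ‖v‖) := fun n t ht => by
    have h1 : ‖Δ n t‖ ≤ Q * ‖Δ n a‖ := (est n).1 t ht
    rw [hΔa'] at h1; linarith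
  set q : ℕ → ℝ → E := fun n t => (δ n)⁻¹ • Δ n t with hq
  have hqb : ∀ n, ∀ t ∈ Icc a b, ‖q n t‖ ≤ Q * ‖v‖ := fun n t ht => by
    rw [hq, norm_smul, norm_inv, Real.norm_of_nonneg (hδ0 n).le, inv_mul_le_iff₀ (hδ0 n)]
    exact hΔb n t ht
  have hlim : ∀ t, ∃ l, t ∈ Icc a b → Tendsto (fun n => q n t) (hyperfilter ℕ) (𝓝 l) ∧
      ‖l‖ ≤ Q * ‖v‖ := by
    intro t
    by_cases ht : t ∈ Icc a b
    · obtain ⟨l, hl⟩ := exists_tendsto_hyperfilter (u := fun n => q n t)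
        (Eventually.of_forall fun n => hqb n t ht)
      exact ⟨l, fun _ => hl⟩
    · exact ⟨0, fun h => absurd h ht⟩
  choose η hη using hlim
  have hU : (hyperfilter ℕ : Filter ℕ) ≤ atTop := Nat.hyperfilter_le_atTop
  have hδlim : Tendsto δ (hyperfilter ℕ) (𝓝 0) :=
    tendsto_one_div_add_atTop_nhds_zero_nat.mono_left hU
  set γ : ℕ → ℝ → F →L[ℝ] E := fun n t =>
    (δ n)⁻¹ • (σ (φ (y₀ + δ n • v) t) - σ (φ y₀ t)) with hγ
  -- The coefficient of the n-th difference quotient differs from Dσ(y) applied to that quotient by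
  -- a Taylor remainder of order δ_n, so it converges to Dσ(y) η.
  have hγlim : ∀ t ∈ Icc a b,
      Tendsto (fun n => γ n t) (hyperfilter ℕ) (𝓝 (fderiv ℝ σ (φ y₀ t) (η t))) := by
    intro t ht
    have h1 : Tendsto (fun n => fderiv ℝ σ (φ y₀ t) (q n t)) (hyperfilter ℕ)
        (𝓝 (fderiv ℝ σ (φ y₀ t) (η t))) :=
      ((fderiv ℝ σ (φ y₀ t)).continuous.tendsto _).comp (hη t ht).1
    have h2 : Tendsto (fun n => γ n t - fderiv ℝ σ (φ y₀ t) (q n t)) (hyperfilter ℕ) (𝓝 0) := by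
      refine squeeze_zero_norm (a := fun n => K * δ n * (Q * ‖v‖) ^ 2) (fun n => ?_) ?_
      · have e : γ n t - fderiv ℝ σ (φ y₀ t) (q n t) = (δ n)⁻¹ •
            (σ (φ (y₀ + δ n • v) t) - σ (φ y₀ t) - fderiv ℝ σ (φ y₀ t) (Δ n t)) := by
          rw [hγ, hq, map_smul, ← smul_sub]
        have h3 := norm_taylor_le hσ.differentiable hσ.norm_fderiv_sub_le hK
          (φ (y₀ + δ n • v) t) (φ y₀ t)
        rw [e, norm_smul, norm_inv, Real.norm_of_nonneg (hδ0 n).le, inv_mul_le_iff₀ (hδ0 n)]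
        calc _ ≤ K * ‖Δ n t‖ ^ 2 := h3
          _ ≤ K * (δ n * (Q * ‖v‖)) ^ 2 := by gcongr; exact hΔb n t ht
          _ = _ := by ring
      · simpa using (hδlim.const_mul K).mul_const ((Q * ‖v‖) ^ 2)
    simpa using h2.add h1
  have hloc : ∀ s t, a ≤ s → s ≤ t → t ≤ b → ω s t ≤ ε →
      ‖η t - η s - fderiv ℝ σ (φ y₀ s) (η s) (x t - x s)‖
        ≤ L * (Q * ‖v‖) * ω s t ^ (2 * α) ∧ ‖η t - η s‖ ≤ L * (Q * ‖v‖) * ω s t ^ α := by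
    intro s t h1 h2 h3 h4
    have hs : s ∈ Icc a b := ⟨h1, h2.trans h3⟩
    have ht : t ∈ Icc a b := ⟨h1.trans h2, h3⟩
    have hw : ∀ β : ℝ, 0 ≤ ω s t ^ β := fun β => Real.rpow_nonneg (hd.control.nonneg s t h1 h2 h3) _
    constructor
    · have hl := ((((hη t ht).1.sub (hη s hs).1)).sub
          ((isBoundedBilinearMap_apply.continuous.tendsto
            (fderiv ℝ σ (φ y₀ s) (η s), x t - x s)).comp
              ((hγlim s hs).prodMk_nhds (tendsto_const_nhds (x := x t - x s))))).norm
      refine le_of_tendsto' hl fun n => ?_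
      have e : q n t - q n s - γ n s (x t - x s) = (δ n)⁻¹ • (Δ n t - Δ n s
          - (σ (φ (y₀ + δ n • v) s) - σ (φ y₀ s)) (x t - x s)) := by
        simp only [hq, hγ]
        rw [smul_apply, ← smul_sub, ← smul_sub]
      change ‖q n t - q n s - γ n s (x t - x s)‖ ≤ _
      rw [e, norm_smul, norm_inv, Real.norm_of_nonneg (hδ0 n).le, inv_mul_le_iff₀ (hδ0 n)]
      calc _ ≤ L * ‖Δ n s‖ * ω s t ^ (2 * α) := (est n).2.1 s t h1 h2 h3 h4
        _ ≤ L * (δ n * (Q * ‖v‖)) * ω s t ^ (2 * α) := by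
          have := hw (2 * α)
          gcongr; exact hΔb n s hs
        _ = _ := by ring
    · refine le_of_tendsto' ((hη t ht).1.sub (hη s hs).1).norm fun n => ?_
      simp only [hq]
      rw [← smul_sub, norm_smul, norm_inv, Real.norm_of_nonneg (hδ0 n).le,
        inv_mul_le_iff₀ (hδ0 n)]
      calc _ ≤ L * ‖Δ n s‖ * ω s t ^ α := (est n).2.2 s t h1 h2 h3 h4
        _ ≤ L * (δ n * (Q * ‖v‖)) * ω s t ^ α := by
          have := hw α
          gcongr; exact hΔb n s hs
        _ = _ := by ring
  have hωε : ∀ s t, a ≤ s → s ≤ t → t ≤ b → t - s ≤ ε / C → ω s t ≤ ε := by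
    intro s t h1 h2 h3 h4
    rw [le_div_iff₀ hC0] at h4
    linarith [hC s t h1 h2 h3]
  have hrp : ∀ β : ℝ, 0 < β → ∀ s t, a ≤ s → s ≤ t → t ≤ b →
      L * (Q * ‖v‖) * ω s t ^ β ≤ L * (Q * ‖v‖) * C ^ β * (t - s) ^ β := by
    intro β hβ s t h1 h2 h3
    rw [mul_assoc _ (C ^ β), ← Real.mul_rpow hC0.le (by linarith)]
    have := Real.rpow_le_rpow (hd.control.nonneg s t h1 h2 h3) (hC s t h1 h2 h3) hβ.le
    gcongr
  have hηd : ∀ s t, a ≤ s → s ≤ t → t ≤ b → ‖η t - η s‖ ≤ 2 * (Q * ‖v‖) := fun s t h1 h2 h3 => by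
    have h4 := (hη s ⟨h1, h2.trans h3⟩).2
    have h5 := (hη t ⟨h1.trans h2, h3⟩).2
    have h6 := norm_sub_le (η t) (η s)
    linarith
  obtain ⟨X, hX0, hX⟩ := (hd.holderBound hα0).bounded hα0
  refine ⟨η, ?_, ?_, ?_⟩
  · refine tendsto_nhds_unique (hη a ⟨le_rfl, hab⟩).1 (tendsto_const_nhds.congr fun n => ?_)
    rw [hq]
    simp only
    rw [hΔa, smul_smul, inv_mul_cancel₀ (hδ0 n).ne', one_smul]
  · exact exists_bound_of_local hα0.le (div_pos hε0 hC0)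
      (fun s t h1 h2 h3 h4 => ((hloc s t h1 h2 h3 (hωε s t h1 h2 h3 h4)).2).trans
        (hrp α hα0 s t h1 h2 h3)) hηd
  · refine exists_bound_of_local (B := 2 * (Q * ‖v‖) + K * (Q * ‖v‖) * (X + X)) (by linarith)
      (div_pos hε0 hC0)
      (fun s t h1 h2 h3 h4 => ((hloc s t h1 h2 h3 (hωε s t h1 h2 h3 h4)).1).trans
        (hrp (2 * α) (by linarith) s t h1 h2 h3)) fun s t h1 h2 h3 => ?_
    refine (norm_sub_le _ _).trans (add_le_add (hηd s t h1 h2 h3) ?_)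
    refine (ContinuousLinearMap.le_opNorm₂ _ _ _).trans ?_
    have h4 := norm_sub_le (x t) (x s)
    have h5 := hX s ⟨h1, h2.trans h3⟩
    have h6 := hX t ⟨h1.trans h2, h3⟩
    gcongr
    · exact hσ.norm_fderiv_le _
    · exact (hη s ⟨h1, h2.trans h3⟩).2
    · linarith

/-- Existence for the linearized equation for matrices. -/
theorem exists_linearized (hα : 1 / 2 < α) (hab : a ≤ b) (hσ : IsC3Bounded K σ)
    (hd : IsDriver α a b x ω) (hφ0 : ∀ y₀, φ y₀ a = y₀)
    (hφ : ∀ y₀, IsDavieSolution α a b x σ (φ y₀)) (y₀ : E) :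
    ∃ ξ : ℝ → E →L[ℝ] E, ξ a = ContinuousLinearMap.id ℝ E ∧ HolderBound α a b ξ ∧
      IsDavie α a b x (fun t => linearizedCoeff σ (φ y₀ t) (ξ t)) ξ := by
  set bs := Module.finBasis ℝ E
  choose η h0 hH hD using fun i => exists_directional hα hab hσ hd hφ0 hφ y₀ (bs i)
  set l : ∀ i, E →L[ℝ] ℝ := fun i => LinearMap.toContinuousLinearMap (bs.coord i) with hl
  -- The matrix solution is assembled from its columns: T i places the vector solution started from
  -- the i-th basis vector into the i-th column.
  set T : ∀ i, E →L[ℝ] E →L[ℝ] E := fun i => ContinuousLinearMap.smulRightL ℝ E E (l i) with hT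
  have hTapply : ∀ i u w, T i u w = bs.repr w i • u := fun i u w => rfl
  refine ⟨fun t => ∑ i, T i (η i t), ?_, ?_, ?_⟩
  · ext w
    simp only [h0, sum_apply, hTapply, ContinuousLinearMap.id_apply]
    exact bs.sum_repr w
  · exact HolderBound.sum _ fun i => (hH i).map (T i)
  · have := IsDavie.sum Finset.univ fun i => (hD i).map (T i)
    refine this.congr (fun t _ => ?_) fun _ _ => rfl
    ext u w
    simp [linearizedCoeff, hTapply]

/-- Existence, uniqueness and differentiability of the flow of a Young equation, with the quadratic
remainder estimate. -/
theorem exists_flow (hα : 1 / 2 < α) (hab : a ≤ b) (hσ : IsC3Bounded K σ)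
    (hd : IsDriver α a b x ω) {ε : ℝ}
    (hε : ∀ w, 0 ≤ w → w ≤ ε → 2 * localConst α (flowConst α K) * w ^ α ≤ 1) {k : ℕ}
    (hk : ω a b ≤ (k + 1) * ε) :
    ∃ φ : E → ℝ → E,
      (∀ y₀, IsUniqueYoungSolution α a b x (fun _ z => σ z) y₀ (φ y₀)) ∧
      (∀ y₀, ∀ t ∈ Icc a b, DifferentiableAt ℝ (fun z => φ z t) y₀) ∧
      (∀ y₀, IsUniqueYoungSolution α a b x (fun t => linearizedCoeff σ (φ y₀ t))
        (ContinuousLinearMap.id ℝ E) (fun t => fderiv ℝ (fun z => φ z t) y₀)) ∧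
      (∀ y₀ y₁, ∀ t ∈ Icc a b,
        ‖φ y₁ t - φ y₀ t - fderiv ℝ (fun z => φ z t) y₀ (y₁ - y₀)‖ ≤
          remainderConst α K k * ‖y₁ - y₀‖ ^ 2) := by
  have hα0 : 0 < α := by linarith
  have hx := hd.holderBound hα0
  choose φ hφ0 hφH hφD using exists_davie hα hσ.nonneg hσ.norm_le hσ.norm_sub_le hx hab
  have hφ : ∀ y₀, IsDavieSolution α a b x σ (φ y₀) := fun y₀ => ⟨hφH y₀, hφD y₀⟩
  choose ξ hξ0 hξH hξD using exists_linearized hα hab hσ hd hφ0 hφ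
  have hrem : ∀ y₀ y₁, ∀ t ∈ Icc a b, ‖φ y₁ t - φ y₀ t - ξ y₀ t (y₁ - y₀)‖ ≤
      remainderConst α K k * ‖y₁ - y₀‖ ^ 2 := fun y₀ y₁ t ht => by
    have := (hφ y₀).remainder_estimate (hφ y₁) hα hσ hd hε hk (hξH y₀) (hξD y₀) (hξ0 y₀) ht
    simpa only [hφ0] using this
  -- The quadratic remainder bound is o(‖z - y₀‖), so ξ is the Fréchet derivative.
  have hder : ∀ y₀, ∀ t ∈ Icc a b, HasFDerivAt (fun z => φ z t) (ξ y₀ t) y₀ := by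
    intro y₀ t ht
    rw [hasFDerivAt_iff_isLittleO]
    have h1 : (fun z => φ z t - φ y₀ t - ξ y₀ t (z - y₀)) =O[𝓝 y₀] fun z => ‖z - y₀‖ ^ 2 :=
      Asymptotics.IsBigO.of_bound (remainderConst α K k) (Eventually.of_forall fun z => by
        rw [norm_pow, norm_norm]; exact hrem y₀ z t ht)
    have h2 : (fun z : E => ‖z - y₀‖ ^ 2) =o[𝓝 y₀] fun z => z - y₀ := by
      have h3 : Tendsto (fun z : E => z - y₀) (𝓝 y₀) (𝓝 0) := by
        have : Continuous fun z : E => z - y₀ := by fun_prop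
        simpa using this.tendsto y₀
      exact (Asymptotics.isLittleO_norm_pow_id one_lt_two).comp_tendsto h3
    exact h1.trans_isLittleO h2
  have hEq : ∀ y₀, EqOn (ξ y₀) (fun t => fderiv ℝ (fun z => φ z t) y₀) (Icc a b) :=
    fun y₀ t ht => (hder y₀ t ht).fderiv.symm
  refine ⟨φ, fun y₀ => ⟨(hφD y₀).isYoungSolution (V := fun _ z => σ z) hα (hφH y₀) (hφ0 y₀),
    fun v hv => ?_⟩, fun y₀ t ht => (hder y₀ t ht).differentiableAt, fun y₀ => ⟨?_, fun v hv => ?_⟩,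
    fun y₀ y₁ t ht => ?_⟩
  · have hvH := (isHolderPath_iff hα0).1 hv.holder
    -- A competing solution is known only through its integral equation; Hölder continuity of its
    -- coefficient puts it in Davie's form, where uniqueness is available.
    have hvD := isDavie_of_hasYoungIntegral hα hx
      (hvH.comp_lipschitz hσ.nonneg hσ.norm_sub_le) hv.integral_eq
    exact (hφ y₀).eqOn ⟨hvH, hvD⟩ hα hσ hd (by rw [hv.initial, hφ0])
  · refine IsDavie.isYoungSolution hα ((hξD y₀).congr (fun t ht => ?_) (hEq y₀))
      ((hξH y₀).congr (hEq y₀)) ?_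
    · have := hEq y₀ ht
      simp only at this ⊢
      rw [this]
    · rw [← hξ0 y₀]; exact (hEq y₀ ⟨le_rfl, hab⟩).symm
  · have hvH := (isHolderPath_iff hα0).1 hv.holder
    have hg : HolderBound α a b fun t => linearizedCoeff σ (φ y₀ t) (v t) := by
      have hc : HolderBound α a b fun t => fderiv ℝ σ (φ y₀ t) :=
        (hφH y₀).comp_lipschitz hσ.nonneg hσ.norm_fderiv_sub_le
      have h1 := hc.bilinear (H := E →L[ℝ] E) (H' := E →L[ℝ] F →L[ℝ] E) hα0 hvH
        (ContinuousLinearMap.compL ℝ E E (F →L[ℝ] E))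
      -- Swapping the two arguments is an isometry, so it preserves the Hölder bound of the composed
      -- map.
      exact h1.comp_lipschitz (f := fun A : E →L[ℝ] F →L[ℝ] E => A.flip) (K := 1) zero_le_one
        fun p q => by
          rw [one_mul]
          refine le_of_eq ?_
          rw [← ContinuousLinearMap.opNorm_flip (p - q)]
          rfl
    have hvD := isDavie_of_hasYoungIntegral hα hx hg hv.integral_eq
    exact ((hφ y₀).linearized_eqOn hα hσ hd (hξH y₀) hvH (hξD y₀) hvD
      (by rw [hv.initial, hξ0])).trans (hEq y₀)
  · rw [(hder y₀ t ht).fderiv]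
    exact hrem y₀ y₁ t ht

end Flow

/-! ### The control given by the variation of a path -/

section

variable {F : Type*} [NormedAddCommGroup F] {x : ℝ → F} {p α a b s u t : ℝ}

/-- The supremum of `∑ ‖x_v - x_u‖ ^ p` over the partitions of `[s, t]`. -/
noncomputable def varSum (p : ℝ) (x : ℝ → F) (s t : ℝ) : ℝ≥0∞ :=
  ⨆ q : {q : ℕ × (ℕ → ℝ) // IsPartition s t q.1 q.2},
    ∑ i ∈ Finset.range q.1.1, ‖x (q.1.2 (i + 1)) - x (q.1.2 i)‖ₑ ^ p

theorem pVar_eq (p : ℝ) (x : ℝ → F) (s t : ℝ) : pVar p x s t = varSum p x s t ^ (1 / p) := by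
  simp only [pVar, varSum, iSup_subtype, iSup_prod]

theorem isPartition_pair (hst : s ≤ t) : IsPartition s t 1 (fun i => if i = 0 then s else t) :=
  ⟨rfl, rfl, fun i hi => by
    obtain rfl : i = 0 := by omega
    simpa using hst⟩

theorem enorm_rpow_le_varSum (hst : s ≤ t) : ‖x t - x s‖ₑ ^ p ≤ varSum p x s t := by
  refine le_trans ?_ (le_iSup (fun q : {q : ℕ × (ℕ → ℝ) // IsPartition s t q.1 q.2} =>
    ∑ i ∈ Finset.range q.1.1, ‖x (q.1.2 (i + 1)) - x (q.1.2 i)‖ₑ ^ p)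
    ⟨(1, fun i => if i = 0 then s else t), isPartition_pair hst⟩)
  simp

/-- Concatenating partitions of [s, u] and [u, t] gives a partition of [s, t] with the sum of the
two values. This superadditivity is what makes the variation a control. -/
theorem varSum_add_le (hsu : s ≤ u) (hut : u ≤ t) :
    varSum p x s u + varSum p x u t ≤ varSum p x s t := by
  have : Nonempty {q : ℕ × (ℕ → ℝ) // IsPartition s u q.1 q.2} := ⟨⟨(1, _), isPartition_pair hsu⟩⟩
  have : Nonempty {q : ℕ × (ℕ → ℝ) // IsPartition u t q.1 q.2} := ⟨⟨(1, _), isPartition_pair hut⟩⟩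
  refine ENNReal.iSup_add_iSup_le fun q q' => ?_
  obtain ⟨⟨n, τ₁⟩, h₁⟩ := q
  obtain ⟨⟨k, τ₂⟩, h₂⟩ := q'
  obtain ⟨τ, h, e₁, e₂⟩ := h₁.append h₂
  refine le_trans (le_of_eq ?_) (le_iSup (fun q : {q : ℕ × (ℕ → ℝ) // IsPartition s t q.1 q.2} =>
    ∑ i ∈ Finset.range q.1.1, ‖x (q.1.2 (i + 1)) - x (q.1.2 i)‖ₑ ^ p) ⟨(n + k, τ), h⟩)
  simp only [Finset.sum_range_add, add_assoc, e₂]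
  congr 1
  refine Finset.sum_congr rfl fun i hi => ?_
  have hi' := Finset.mem_range.1 hi
  rw [e₁ _ hi'.le, e₁ _ (Nat.succ_le_of_lt hi')]

/-- The power 1/α turns the Hölder bound into one linear in the time increments, which telescope. -/
theorem varSum_le (hα : 0 < α) {C : ℝ} (hC0 : 0 ≤ C)
    (hC : ∀ s t, a ≤ s → s ≤ t → t ≤ b → ‖x t - x s‖ ≤ C * (t - s) ^ α)
    (hs : a ≤ s) (ht : t ≤ b) :
    varSum (1 / α) x s t ≤ ENNReal.ofReal (C ^ (1 / α) * (t - s)) := by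
  refine iSup_le fun q => ?_
  obtain ⟨⟨n, τ⟩, h⟩ := q
  replace h : IsPartition s t n τ := h
  have hterm : ∀ i ∈ Finset.range n, ‖x (τ (i + 1)) - x (τ i)‖ₑ ^ (1 / α)
      ≤ ENNReal.ofReal (C ^ (1 / α) * (τ (i + 1) - τ i)) := by
    intro i hi
    have hi' := Finset.mem_range.1 hi
    have hle := h.step_le i hi'
    rw [← ofReal_norm, ENNReal.ofReal_rpow_of_nonneg (norm_nonneg _) (by positivity)]
    refine ENNReal.ofReal_le_ofReal ?_
    have h1 := hC _ _ (hs.trans (h.mem_Icc hi'.le).1) hle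
      ((h.mem_Icc (Nat.succ_le_of_lt hi')).2.trans ht)
    have h0 : 0 ≤ τ (i + 1) - τ i := by linarith
    calc _ ≤ (C * (τ (i + 1) - τ i) ^ α) ^ (1 / α) :=
          Real.rpow_le_rpow (norm_nonneg _) h1 (by positivity)
      _ = _ := by
        rw [Real.mul_rpow hC0 (Real.rpow_nonneg h0 _), ← Real.rpow_mul h0,
          mul_one_div_cancel hα.ne', Real.rpow_one]
  refine (Finset.sum_le_sum hterm).trans (le_of_eq ?_)
  rw [← ENNReal.ofReal_sum_of_nonneg, ← Finset.mul_sum, Finset.sum_range_sub, h.first, h.last]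
  intro i hi
  have := h.step_le i (Finset.mem_range.1 hi)
  exact mul_nonneg (by positivity) (by linarith)

/-- The control of a Hölder path given by its variation. -/
theorem HolderBound.isDriver (hα : 0 < α) (hx : HolderBound α a b x) :
    IsDriver α a b x fun s t => (varSum (1 / α) x s t).toReal + (t - s) := by
  -- The summand t - s makes the control dominate elapsed time, even where x is constant; it adds
  -- only b - a to the total control.
  obtain ⟨C, hC0, hC⟩ := hx
  have hle := fun (s t : ℝ) (h1 : a ≤ s) (h3 : t ≤ b) => varSum_le hα hC0 hC h1 h3
  have hfin : ∀ s t, a ≤ s → t ≤ b → varSum (1 / α) x s t ≠ ∞ := fun s t h1 h3 =>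
    ((hle s t h1 h3).trans_lt ENNReal.ofReal_lt_top).ne
  refine ⟨⟨fun s t h1 h2 h3 => ?_, fun s u t h1 h2 h3 h4 => ?_⟩, fun s t h1 h2 h3 => ?_,
    ⟨C ^ (1 / α) + 1, by positivity, fun s t h1 h2 h3 => ?_⟩, fun s t h1 h2 h3 => ?_⟩
  · have : 0 ≤ t - s := by linarith
    positivity
  · have h5 := ENNReal.toReal_mono (hfin s t h1 h4) (varSum_add_le (p := 1 / α) (x := x) h2 h3)
    rw [ENNReal.toReal_add (hfin s u h1 (h3.trans h4)) (hfin u t (h1.trans h2) h4)] at h5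
    linarith
  · exact le_add_of_nonneg_left ENNReal.toReal_nonneg
  · have h0 : 0 ≤ t - s := by linarith
    have h4 := ENNReal.toReal_mono ENNReal.ofReal_ne_top (hle s t h1 h3)
    rw [ENNReal.toReal_ofReal (by positivity)] at h4
    linarith
  · have h0 : 0 ≤ t - s := by linarith
    have h4 := ENNReal.toReal_mono (hfin s t h1 h3) (enorm_rpow_le_varSum (p := 1 / α) (x := x) h2)
    rw [← ENNReal.toReal_rpow, toReal_enorm] at h4
    calc ‖x t - x s‖ = (‖x t - x s‖ ^ (1 / α)) ^ α := by
          rw [← Real.rpow_mul (norm_nonneg _), one_div_mul_cancel hα.ne', Real.rpow_one]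
      _ ≤ _ := Real.rpow_le_rpow (by positivity) (by linarith) hα.le

theorem toReal_varSum_eq (hα : 0 < α) :
    (varSum (1 / α) x a b).toReal = (pVar (1 / α) x a b).toReal ^ (1 / α) := by
  rw [pVar_eq, ENNReal.toReal_rpow, ← ENNReal.rpow_mul, one_div_one_div,
    mul_one_div_cancel hα.ne', ENNReal.rpow_one]

end

/-- The deterministic form of the theorem: the constant depends on the driving path through its
variation only. -/
theorem exists_flow_of_holder (α a b K : ℝ) (hα : 1 / 2 < α) (hab : a ≤ b) :
    ∃ D : ℝ → ℝ, ∀ {E F : Type} [NormedAddCommGroup E] [NormedSpace ℝ E] [FiniteDimensional ℝ E]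
      [NormedAddCommGroup F] [NormedSpace ℝ F] (σ : E → F →L[ℝ] E), IsC3Bounded K σ →
      ∀ x : ℝ → F, HolderBound α a b x →
      ∃ φ : E → ℝ → E,
        (∀ y₀, IsUniqueYoungSolution α a b x (fun _ z => σ z) y₀ (φ y₀)) ∧
        (∀ y₀, ∀ t ∈ Icc a b, DifferentiableAt ℝ (fun z => φ z t) y₀) ∧
        (∀ y₀, IsUniqueYoungSolution α a b x (fun t => linearizedCoeff σ (φ y₀ t))
          (ContinuousLinearMap.id ℝ E) (fun t => fderiv ℝ (fun z => φ z t) y₀)) ∧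
        (∀ y₀ y₁, ∀ t ∈ Icc a b,
          ‖φ y₁ t - φ y₀ t - fderiv ℝ (fun z => φ z t) y₀ (y₁ - y₀)‖ ≤
            D (pVar (1 / α) x a b).toReal * ‖y₁ - y₀‖ ^ 2) := by
  -- For negative K no admissible σ exists, so any function serves.
  by_cases hK : 0 ≤ K
  swap
  · exact ⟨0, fun σ hσ => absurd hσ.nonneg hK⟩
  obtain ⟨ε, hε0, hε⟩ := exists_small_flowConst hα hK
  -- The number of windows is chosen as a function of the variation ρ before any path is given, so
  -- the constant depends on the path through ρ only.
  choose k hk using fun ρ : ℝ => exists_mul_ge hε0 (ρ ^ (1 / α) + (b - a))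
  refine ⟨fun ρ => remainderConst α K (k ρ), fun σ hσ x hx => ?_⟩
  refine exists_flow hα hab hσ (hx.isDriver (by linarith)) hε ?_
  rw [toReal_varSum_eq (by linarith)]
  exact hk _

/-! ### Dyadic chaining -/

section Chaining

variable {E : Type*} [NormedAddCommGroup E] {α C : ℝ}

/-- The chaining argument on the dyadic points of `[0, 1]`. -/
theorem holderBound_of_dyadic {g : ℝ → E} (hα : 0 < α) (hg : ContinuousOn g (Icc 0 1))
    (hC0 : 0 ≤ C) (hC : ∀ n j : ℕ, j < 2 ^ n →
      ‖g ((j + 1 : ℕ) / 2 ^ n) - g (j / 2 ^ n)‖ ≤ C * ((1 / 2) ^ α) ^ n) :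
    HolderBound α 0 1 g := by
  set r : ℝ := (1 / 2) ^ α with hr
  have hr0 : 0 < r := by positivity
  have hr1 : r < 1 := Real.rpow_lt_one (by norm_num) (by norm_num) hα
  -- The dyadic point of level n just below u. Passing from level n to n + 1 moves it by at most one
  -- step of level n + 1, so the distances to the limit sum geometrically.
  set d : ℕ → ℝ → ℝ := fun n u => (⌊u * 2 ^ n⌋₊ : ℝ) / 2 ^ n with hd
  have hfl : ∀ n : ℕ, ∀ u ∈ Icc (0 : ℝ) 1, ⌊u * 2 ^ n⌋₊ ≤ 2 ^ n := fun n u hu => by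
    refine Nat.floor_le_of_le ?_
    push_cast
    nlinarith [hu.2, show (0 : ℝ) < 2 ^ n by positivity]
  have hadj : ∀ (n : ℕ) (i j : ℕ), i ≤ j → j ≤ i + 1 → j ≤ 2 ^ n →
      ‖g (j / 2 ^ n) - g (i / 2 ^ n)‖ ≤ C * r ^ n := by
    intro n i j h1 h2 h3
    rcases h1.eq_or_lt with rfl | h
    · rw [sub_self, norm_zero]; positivity
    · obtain rfl : j = i + 1 := by omega
      exact hC n i (by omega)
  have hdmem : ∀ n, ∀ u ∈ Icc (0 : ℝ) 1, d n u ∈ Icc (0 : ℝ) 1 := fun n u hu => by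
    refine ⟨by positivity, ?_⟩
    simp only [hd]
    rw [div_le_one (by positivity)]
    exact_mod_cast hfl n u hu
  have hdlim : ∀ u ∈ Icc (0 : ℝ) 1, Tendsto (fun n => g (d n u)) atTop (𝓝 (g u)) := by
    intro u hu
    have h1 : Tendsto (fun n => d n u) atTop (𝓝 u) :=
      (tendsto_nat_floor_mul_div_atTop hu.1).comp (tendsto_pow_atTop_atTop_of_one_lt one_lt_two)
    exact (hg u hu).tendsto.comp (tendsto_nhdsWithin_iff.2
      ⟨h1, Eventually.of_forall fun n => hdmem n u hu⟩)
  have hstep : ∀ u ∈ Icc (0 : ℝ) 1, ∀ n, dist (g (d n u)) (g (d (n + 1) u)) ≤ C * r * r ^ n := by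
    intro u hu n
    have e : d n u = ((2 * ⌊u * 2 ^ n⌋₊ : ℕ) : ℝ) / 2 ^ (n + 1) := by
      simp only [hd]; push_cast; rw [pow_succ]; field_simp
    have h0 : 0 ≤ u * 2 ^ n := mul_nonneg hu.1 (by positivity)
    have f1 := Nat.floor_le h0
    have f2 := Nat.lt_floor_add_one (u * 2 ^ n)
    have e2 : u * 2 ^ (n + 1) = 2 * (u * 2 ^ n) := by ring
    rw [dist_comm, dist_eq_norm, e]
    refine (hadj (n + 1) (2 * ⌊u * 2 ^ n⌋₊) ⌊u * 2 ^ (n + 1)⌋₊ ?_ ?_ (hfl _ u hu)).trans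
      (le_of_eq (by ring))
    · refine Nat.le_floor ?_
      rw [e2]; push_cast; linarith
    · refine Nat.lt_succ_iff.1 ((Nat.floor_lt (by rw [e2]; positivity)).2 ?_)
      rw [e2]; push_cast; linarith
  have hchain : ∀ u ∈ Icc (0 : ℝ) 1, ∀ n, ‖g (d n u) - g u‖ ≤ C * r * r ^ n / (1 - r) :=
    fun u hu n => by
      rw [← dist_eq_norm]
      exact dist_le_of_le_geometric_of_tendsto r (C * r) hr1 (hstep u hu) (hdlim u hu) n
  have h1r : 0 < 1 - r := by linarith
  refine ⟨C * (1 + 2 * r / (1 - r)) * 2 ^ α, by positivity, fun u v hu huv hv => ?_⟩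
  rcases huv.eq_or_lt with rfl | hlt
  · rw [sub_self, norm_zero, sub_self, Real.zero_rpow hα.ne', mul_zero]
  have hu' : u ∈ Icc (0 : ℝ) 1 := ⟨hu, huv.trans hv⟩
  have hv' : v ∈ Icc (0 : ℝ) 1 := ⟨hu.trans huv, hv⟩
  -- The level with 2^(-n-1) < v - u ≤ 2^(-n): the upper bound makes the approximations of u and v
  -- equal or adjacent, the lower one turns r^n into (v - u)^α at the cost of 2^α.
  obtain ⟨n, hn1, hn2⟩ := exists_nat_pow_near_of_lt_one (x := v - u) (y := (1 / 2 : ℝ))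
    (by linarith) (by linarith) (by norm_num) (by norm_num)
  have hp : (0 : ℝ) < 2 ^ n := by positivity
  have h0 : 0 ≤ u * 2 ^ n := mul_nonneg hu hp.le
  have hmid : ‖g (d n v) - g (d n u)‖ ≤ C * r ^ n := by
    refine hadj n _ _ (Nat.floor_le_floor (by gcongr)) ?_ (hfl n v hv')
    have h3 : v * 2 ^ n ≤ u * 2 ^ n + 1 := by
      rw [one_div_pow] at hn2
      have := mul_le_mul_of_nonneg_right hn2 hp.le
      rw [one_div_mul_cancel hp.ne'] at this
      linarith
    refine (Nat.floor_le_floor h3).trans ?_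
    rw [Nat.floor_add_one h0]
  have hrn : r ^ n ≤ 2 ^ α * (v - u) ^ α := by
    rw [← Real.mul_rpow (by norm_num) (by linarith), hr, ← Real.rpow_natCast, ← Real.rpow_mul
      (by norm_num), mul_comm α, Real.rpow_mul (by norm_num), Real.rpow_natCast]
    refine Real.rpow_le_rpow (by positivity) ?_ hα.le
    rw [pow_succ] at hn1
    linarith
  have c1 := hchain u hu' n
  have c2 := hchain v hv' n
  have e : g v - g u = (g (d n v) - g (d n u)) + (g (d n u) - g u) - (g (d n v) - g v) := by abel
  calc ‖g v - g u‖ ≤ ‖g (d n v) - g (d n u)‖ + ‖g (d n u) - g u‖ + ‖g (d n v) - g v‖ := by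
        rw [e]
        exact (norm_sub_le _ _).trans (by gcongr; exact norm_add_le _ _)
    _ ≤ C * r ^ n + C * r * r ^ n / (1 - r) + C * r * r ^ n / (1 - r) := by gcongr
    _ = C * (1 + 2 * r / (1 - r)) * r ^ n := by field_simp; ring
    _ ≤ C * (1 + 2 * r / (1 - r)) * (2 ^ α * (v - u) ^ α) := by gcongr
    _ = _ := by ring

theorem holderBound_of_dyadic_Icc {f : ℝ → E} {a b : ℝ} (hα : 0 < α) (hab : a < b)
    (hf : ContinuousOn f (Icc a b)) (hC0 : 0 ≤ C) (hC : ∀ n j : ℕ, j < 2 ^ n →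
      ‖f (a + (j + 1 : ℕ) / 2 ^ n * (b - a)) - f (a + j / 2 ^ n * (b - a))‖
        ≤ C * ((1 / 2) ^ α) ^ n) :
    HolderBound α a b f := by
  have hba : 0 < b - a := by linarith
  obtain ⟨M, hM0, hM⟩ := holderBound_of_dyadic (g := fun u => f (a + u * (b - a))) hα
    (hf.comp (by fun_prop) fun u hu => ⟨by nlinarith [hu.1], by nlinarith [hu.2]⟩) hC0 hC
  refine ⟨M / (b - a) ^ α, by positivity, fun s t h1 h2 h3 => ?_⟩
  have := hM ((s - a) / (b - a)) ((t - a) / (b - a)) (div_nonneg (by linarith) hba.le)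
    (by gcongr) (by rw [div_le_one hba]; linarith)
  simp only [div_mul_cancel₀ _ hba.ne', add_sub_cancel, ← sub_div, sub_sub_sub_cancel_right] at this
  rw [Real.div_rpow (by linarith) hba.le] at this
  refine this.trans (le_of_eq (by ring))

end Chaining

/-! ### Hölder regularity of fractional Brownian paths -/

section Gaussian

variable {Ω : Type*} [MeasurableSpace Ω] {P : Measure Ω}

/-- Absolute moments of the standard Gaussian law. -/
noncomputable def gaussianMoment (q : ℝ) : ℝ≥0∞ := ∫⁻ y, ‖y‖ₑ ^ q ∂(gaussianReal 0 1)

theorem gaussianMoment_lt_top {q : ℝ} (hq : 0 < q) : gaussianMoment q < ∞ := by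
  have h := (memLp_id_gaussianReal (μ := 0) (v := 1) q.toNNReal).2
  rw [eLpNorm_lt_top_iff_lintegral_rpow_enorm_lt_top (by simpa using hq) (by simp)] at h
  simpa [gaussianMoment, Real.coe_toNNReal _ hq.le] using h

/-- X has the law of c times a standard Gaussian variable, so every moment is a power of the
standard deviation times a universal constant. -/
theorem lintegral_rpow_gaussian {X : Ω → ℝ} (hX : HasGaussianLaw X P) (h0 : P[X] = 0) {c : ℝ}
    (hc : 0 ≤ c) (hvar : Var[X; P] = c ^ 2) {q : ℝ} (hq : 0 ≤ q) :
    ∫⁻ ω, ‖X ω‖ₑ ^ q ∂P = ENNReal.ofReal c ^ q * gaussianMoment q := by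
  have hmap : P.map X = (gaussianReal 0 1).map (c * ·) := by
    rw [hX.map_eq_gaussianReal, h0, hvar, gaussianReal_map_const_mul, mul_zero, mul_one]
    congr 1
    ext
    simp [sq_nonneg]
  have hm : Measurable fun y : ℝ => ‖y‖ₑ ^ q := by fun_prop
  calc ∫⁻ ω, ‖X ω‖ₑ ^ q ∂P = ∫⁻ y, ‖y‖ₑ ^ q ∂(P.map X) :=
        (lintegral_map' hm.aemeasurable hX.aemeasurable).symm
    _ = ∫⁻ y, ‖c * y‖ₑ ^ q ∂(gaussianReal 0 1) := by
        rw [hmap, lintegral_map hm (by fun_prop)]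
    _ = _ := by
        rw [gaussianMoment, ← lintegral_const_mul _ hm]
        refine lintegral_congr fun y => ?_
        rw [enorm_mul, ENNReal.mul_rpow_of_nonneg _ _ hq, Real.enorm_of_nonneg hc]

/-- The dyadic form of Kolmogorov's continuity criterion for real Gaussian processes. -/
theorem ae_exists_dyadic_bound {X : ℝ → Ω → ℝ} {a b H α : ℝ} (hab : a < b) (hαH : α < H)
    (hX : ∀ s t, HasGaussianLaw (fun ω => X t ω - X s ω) P)
    (h0 : ∀ s t, ∫ ω, X t ω - X s ω ∂P = 0)
    (hvar : ∀ s t, Var[fun ω => X t ω - X s ω; P] = (|t - s| ^ H) ^ 2) :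
    ∀ᵐ ω ∂P, ∃ C, 0 ≤ C ∧ ∀ n j : ℕ, j < 2 ^ n →
      ‖X (a + (j + 1 : ℕ) / 2 ^ n * (b - a)) ω - X (a + j / 2 ^ n * (b - a)) ω‖
        ≤ C * ((1 / 2) ^ α) ^ n := by
  -- The choice q (H - α) > 1 lets the moment decay beat the 2^n increments of level n.
  obtain ⟨q, hq⟩ := exists_gt (1 / (H - α))
  have hHα : 0 < H - α := by linarith
  have hq0 : 0 < q := (one_div_pos.2 hHα).trans hq
  rw [div_lt_iff₀ hHα] at hq
  set r : ℝ := (1 / 2) ^ α with hr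
  have hr0 : 0 < r := by positivity
  set Y : ℕ → ℕ → Ω → ℝ := fun n j ω =>
    X (a + (j + 1 : ℕ) / 2 ^ n * (b - a)) ω - X (a + j / 2 ^ n * (b - a)) ω with hY
  -- S dominates each r^(-nq) |Y|^q, so wherever S is finite S^(1/q) is a constant valid for all
  -- levels. It is finite almost surely because its integral is.
  set S : Ω → ℝ≥0∞ := fun ω => ∑' n : ℕ, ∑ j ∈ Finset.range (2 ^ n),
    ENNReal.ofReal ((r ^ n)⁻¹) ^ q * ‖Y n j ω‖ₑ ^ q with hS
  have hYm : ∀ n j, AEMeasurable (Y n j) P := fun n j => (hX _ _).aemeasurable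
  have hYm' : ∀ n j, AEMeasurable
      (fun ω => ENNReal.ofReal ((r ^ n)⁻¹) ^ q * ‖Y n j ω‖ₑ ^ q) P := fun n j =>
    ((hYm n j).enorm.pow_const q).const_mul _
  have hYint : ∀ n j, ∫⁻ ω, ‖Y n j ω‖ₑ ^ q ∂P
      = ENNReal.ofReal (((b - a) / 2 ^ n) ^ H) ^ q * gaussianMoment q := by
    intro n j
    refine lintegral_rpow_gaussian (hX _ _) (h0 _ _) (by
      have : 0 < b - a := by linarith
      positivity) ?_ hq0.le
    rw [hvar]
    congr 3
    rw [abs_of_nonneg]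
    · push_cast; ring
    · have : 0 ≤ (b - a) / 2 ^ n := div_nonneg (by linarith) (by positivity)
      refine this.trans (le_of_eq ?_)
      push_cast; ring
  -- Level n contributes ρ^n to the integral up to a constant factor: 2 counts increments, r⁻¹ is
  -- the weight and (1/2)^H the standard deviation. Equivalently ρ = 2^(1 - (H - α) q) < 1.
  set ρ : ℝ := 2 * (r⁻¹ * (1 / 2) ^ H) ^ q with hρ
  have hρ0 : 0 ≤ ρ := by positivity
  have hρ1 : ρ < 1 := by
    have e : ρ = 2 ^ (1 + (α - H) * q) := by
      rw [hρ, hr, ← Real.rpow_neg (by norm_num), ← Real.rpow_add (by norm_num),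
        one_div, Real.inv_rpow (by norm_num), ← Real.rpow_neg (by norm_num),
        ← Real.rpow_mul (by norm_num), Real.rpow_add (by norm_num), Real.rpow_one]
      ring_nf
    rw [e]
    exact Real.rpow_lt_one_of_one_lt_of_neg one_lt_two (by linarith)
  have hSint : ∫⁻ ω, S ω ∂P < ∞ := by
    have e : ∫⁻ ω, S ω ∂P
        = ∑' n : ℕ, ENNReal.ofReal (((b - a) ^ H) ^ q) * gaussianMoment q * ENNReal.ofReal ρ ^ n := by
      rw [hS, lintegral_tsum fun n => Finset.aemeasurable_fun_sum _ fun j _ => hYm' n j]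
      refine tsum_congr fun n => ?_
      rw [lintegral_finsetSum' _ fun j _ => hYm' n j]
      simp_rw [lintegral_const_mul'' _ ((hYm n _).enorm.pow_const q), hYint]
      rw [Finset.sum_const, Finset.card_range, nsmul_eq_mul]
      have hba : 0 < b - a := by linarith
      have key : (2 : ℝ) ^ n * ((r ^ n)⁻¹ ^ q * (((b - a) / 2 ^ n) ^ H) ^ q)
          = ((b - a) ^ H) ^ q * ρ ^ n := by
        have hdiv : ((b - a) / 2 ^ n) ^ H = (b - a) ^ H * ((1 / 2) ^ H) ^ n := by
          rw [div_eq_mul_one_div, ← one_div_pow, Real.mul_rpow hba.le (by positivity),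
            Real.rpow_pow_comm (by norm_num)]
        rw [hρ, mul_pow, Real.rpow_pow_comm (x := r⁻¹ * (1 / 2) ^ H) (by positivity), mul_pow, inv_pow, hdiv,
          Real.mul_rpow (by positivity) (by positivity),
          Real.mul_rpow (by positivity) (by positivity)]
        ring
      rw [← ENNReal.ofReal_pow hρ0, mul_right_comm, ← ENNReal.ofReal_mul (by positivity), ← key,
        ENNReal.ofReal_mul (by positivity), ENNReal.ofReal_mul (by positivity),
        ENNReal.ofReal_rpow_of_nonneg (by positivity) hq0.le,
        ENNReal.ofReal_rpow_of_nonneg (by positivity) hq0.le,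
        ENNReal.ofReal_pow (by norm_num)]
      simp only [ENNReal.ofReal_ofNat, Nat.cast_pow, Nat.cast_ofNat]
      ring
    rw [e, ENNReal.tsum_mul_left, ENNReal.tsum_geometric]
    refine ENNReal.mul_lt_top (ENNReal.mul_lt_top ENNReal.ofReal_lt_top
      (gaussianMoment_lt_top hq0)) ?_
    rw [ENNReal.inv_lt_top, tsub_pos_iff_lt]
    exact ENNReal.ofReal_lt_one.2 hρ1
  have hSm : AEMeasurable S P :=
    AEMeasurable.tsum fun n => Finset.aemeasurable_fun_sum _ fun j _ => hYm' n j
  filter_upwards [ae_lt_top' hSm hSint.ne] with ω hω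
  refine ⟨(S ω).toReal ^ (1 / q), by positivity, fun n j hj => ?_⟩
  have h1 : ENNReal.ofReal ((r ^ n)⁻¹) ^ q * ‖Y n j ω‖ₑ ^ q ≤ S ω :=
    (Finset.single_le_sum (f := fun j => ENNReal.ofReal ((r ^ n)⁻¹) ^ q * ‖Y n j ω‖ₑ ^ q)
      (fun _ _ => zero_le) (Finset.mem_range.2 hj)).trans (ENNReal.le_tsum n)
  have h2 := ENNReal.toReal_mono hω.ne h1
  rw [← ENNReal.mul_rpow_of_nonneg _ _ hq0.le, ← ENNReal.toReal_rpow, ENNReal.toReal_mul,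
    ENNReal.toReal_ofReal (by positivity), toReal_enorm] at h2
  have h3 := Real.rpow_le_rpow (by positivity) h2 (show 0 ≤ 1 / q by positivity)
  rw [← Real.rpow_mul (by positivity), mul_one_div_cancel hq0.ne', Real.rpow_one,
    inv_mul_le_iff₀ (by positivity)] at h3
  rwa [mul_comm] at h3

end Gaussian

/-- The paths of fractional Brownian motion are Hölder continuous of all orders `α < H`. -/
theorem IsFractionalBrownianMotion.ae_holderBound {Ω : Type*} [MeasurableSpace Ω] {P : Measure Ω}
    {d : ℕ} {H : ℝ} {B : ℝ → Ω → EuclideanSpace ℝ (Fin d)}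
    (hB : IsFractionalBrownianMotion H B P) {α a b : ℝ} (hα : 0 < α) (hαH : α < H) (hab : a ≤ b) :
    ∀ᵐ ω ∂P, HolderBound α a b fun t => B t ω := by
  rcases hab.eq_or_lt with rfl | hab
  · refine Eventually.of_forall fun ω => ⟨0, le_rfl, fun s t h1 h2 h3 => ?_⟩
    rw [le_antisymm h2 (h3.trans h1), sub_self, norm_zero, zero_mul]
  have hP := hB.gaussian.isProbabilityMeasure
  have hH : 0 < H := hα.trans hαH
  have hinc : ∀ (i : Fin d) (s t : ℝ), HasGaussianLaw (fun ω => B t ω i - B s ω i) P :=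
    fun i s t => (hB.gaussian.hasGaussianLaw_fun_sub (s := t) (t := s)).map_fun
      (EuclideanSpace.proj (𝕜 := ℝ) i)
  have hcoord : ∀ (i : Fin d) (t : ℝ), HasGaussianLaw (fun ω => B t ω i) P :=
    fun i t => (hB.gaussian.hasGaussianLaw_eval t).map_fun (EuclideanSpace.proj (𝕜 := ℝ) i)
  have hdy := fun i : Fin d => ae_exists_dyadic_bound (X := fun t ω => B t ω i) hab hαH (hinc i)
    (fun s t => by
      rw [integral_sub (hcoord i t).integrable (hcoord i s).integrable, hB.centered, hB.centered,
        sub_zero])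
    (fun s t => by
      -- Expanding the variance, the terms |s|^(2H) and |t|^(2H) of the covariance cancel and |t -
      -- s|^(2H) remains.
      rw [variance_fun_sub (hcoord i t).memLp_two (hcoord i s).memLp_two,
        ← covariance_self (hcoord i t).aemeasurable, ← covariance_self (hcoord i s).aemeasurable,
        hB.covariance, hB.covariance, hB.covariance]
      simp only [if_true, sub_self, abs_zero, Real.zero_rpow (show 2 * H ≠ 0 by positivity)]
      rw [← Real.rpow_natCast, ← Real.rpow_mul (abs_nonneg _), abs_sub_comm s t]
      push_cast
      ring_nf)
  filter_upwards [ae_all_iff.2 hdy, hB.continuous_paths] with ω h1 h2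
  have h3 : ∀ i, HolderBound α a b fun t => B t ω i := fun i => by
    obtain ⟨C, hC0, hC⟩ := h1 i
    exact holderBound_of_dyadic_Icc hα hab
      ((EuclideanSpace.proj (𝕜 := ℝ) i).continuous.comp h2).continuousOn hC0 hC
  have h4 := HolderBound.sum Finset.univ fun i => (h3 i).map
    (ContinuousLinearMap.toSpanSingleton ℝ (EuclideanSpace.basisFun (Fin d) ℝ i))
  refine h4.congr fun t _ => ?_
  simpa using (EuclideanSpace.basisFun (Fin d) ℝ).sum_repr (B t ω)

end YoungEq

theorem theoremA3 (m d : ℕ) (α a b K : ℝ) (hα : 1 / 2 < α) (hab : a ≤ b) :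
    -- the constant in the remainder, as a function of the `1/α`-variation of the path alone
    ∃ D : ℝ → ℝ,
      ∀ (σ : EuclideanSpace ℝ (Fin m) →
          EuclideanSpace ℝ (Fin d) →L[ℝ] EuclideanSpace ℝ (Fin m)), IsCb3 K σ →
      ∀ H : ℝ, α < H → H < 1 →
      ∀ (Ω : Type*) [MeasurableSpace Ω] (P : Measure Ω) [IsProbabilityMeasure P]
        (B : ℝ → Ω → EuclideanSpace ℝ (Fin d)), IsFractionalBrownianMotion H B P →
      ∀ᵐ ω ∂P,
        -- `φ y₀ t` is the solution at time `t` with initial datum `y₀`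
        ∃ φ : EuclideanSpace ℝ (Fin m) → ℝ → EuclideanSpace ℝ (Fin m),
          (∀ y₀, IsUniqueYoungSolution α a b (fun t => B t ω) (fun _ z => σ z) y₀ (φ y₀)) ∧
          (∀ y₀, ∀ t ∈ Icc a b, DifferentiableAt ℝ (fun z => φ z t) y₀) ∧
          (∀ y₀, IsUniqueYoungSolution α a b (fun t => B t ω) (linearizedField σ (φ y₀))
            (ContinuousLinearMap.id ℝ (EuclideanSpace ℝ (Fin m)))
            (fun t => fderiv ℝ (fun z => φ z t) y₀)) ∧
          (∀ y₀ y₁, ∀ t ∈ Icc a b,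
            ‖φ y₁ t - φ y₀ t - fderiv ℝ (fun z => φ z t) y₀ (y₁ - y₀)‖ ≤
              D (pVar (1 / α) (fun t => B t ω) a b).toReal * ‖y₁ - y₀‖ ^ 2) := by
  obtain ⟨D, hD⟩ := exists_flow_of_holder α a b K hα hab
  refine ⟨D, fun σ hσ H hαH _ Ω _ P _ B hB => ?_⟩
  filter_upwards [hB.ae_holderBound (by linarith) hαH hab] with ω hω
  -- `linearizedField` and `linearizedCoeff` agree by definition, so the deterministic statement
  -- applies verbatim.
  exact hD σ (isC3Bounded_of_iteratedFDeriv hσ.contDiff hσ.bound) _ hω
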